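/- Let $\mathcal H$ be a separable complex Hilbert space (of finite or infinite dimension) and $\mathcal D$ its set of states (positive operators of trace one). Let $(e^{t\mathcal L})_{t\ge 0}$ be Lindblad dynamics, i.e. a quantum dynamical semigroup: a strongly continuous semigroup of completely positive trace-preserving linear maps on the trace-class operators; write $\omega(t)=e^{t\mathcal L}(\omega)$. Let $S(\omega)=-\mathrm{tr}\{\omega\ln\omega\}\in[0,\infty]$ be the von Neumann entropy and $S(\rho\Vert\varphi)=\mathrm{tr}\{\rho(\ln\rho-\ln\varphi)\}$ if $\mathrm{supp}\,\rho\subseteq\mathrm{supp}\,\varphi$, $=\infty$ otherwise, the relative entropy. Let $\dot Q:\mathcal D\to\mathbb R\cup\{\infty\}$ be linear (i.e. compatible with convex mixtures), and define the entropy production rate $$\dot\Sigma(\omega)=\tfrac{d}{dt}S(\omega(t))\big|_{t=0^+}+\dot Q(\omega),$$ with $\dot\Sigma(\omega)=\infty$ if $S(\omega)=\infty$, and with the derivative read as the upper right derivative in $[-\infty,\infty]$ where the limit does not exist. Let $\mathcal S\subseteq\mathcal D$ be convex, let $\varphi\in\arg\min_{\omega\in\mathcal S}\dot\Sigma(\omega)$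 and $\rho\in\mathcal S$, and put $\varphi(\lambda)=(1-\lambda)\varphi+\lambda\rho$ for $\lambda\in\mathbb R$. Assume that $S(\rho\Vert\varphi)<\infty$ and that $\dot\Sigma(\rho)$ and $\dot\Sigma(\varphi)$ are finite (with $S$ and $\dot Q$ finite at $\rho$ and $\varphi$, and the entropy derivatives there existing as finite limits). Assume also that for some $\tau>0$ and every $\lambda\in[0,1]$, along the trajectory $t\mapsto e^{t\mathcal L}(\varphi(\lambda))$, $t\in[0,\tau]$, the entropy $S$ is finite and absolutely continuous and $\dot Q$ is finite and continuous (so that $\int_0^t\dot\Sigma(e^{s\mathcal L}(\varphi(\lambda)))\,ds$ is well defined and equals the entropy change plus the integrated entropy flow). Suppose that the following one-sided derivatives at $\lambda=0$, $t=0$ exist, are finite and agree (with $\dot\Sigma(\varphi(\lambda))$ finite for all small $\lambda\ge0$): $$\partial_\lambda^+\dot\Sigma(\varphi(\lambda))=\partial_t^+\partial_\lambda^+\int_0^t\dot\Sigma(e^{s\mathcal L}(\varphi(\lambda)))\,ds .\tag{1}$$ Then $S(\rho(t)\Vert\varphi(t))$ is finite for all small $t\ge 0$, its right derivative $\frac{d}{dt}S(\rho(t)\Vert\varphi(t))$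 at $t=0$ exists and is finite, and $$\dot\Sigma(\rho)-\dot\Sigma(\varphi)\ \ge\ -\tfrac{d}{dt}S(\rho(t)\Vert\varphi(t)).$$ Consequently, if moreover $\dot\Sigma(\varphi)\ge 0$ (second law), then $\dot\Sigma(\rho)\ge-\frac{d}{dt}S(\rho(t)\Vert\varphi(t))$. Furthermore, if $\varphi(\lambda)\in\mathcal S$ for some $\lambda<0$, and if the following condition holds: whenever $\varphi\ge\alpha\rho$ for some $\alpha>0$, the function $\lambda\mapsto\dot\Sigma(\varphi(\lambda))$ is finite and continuously differentiable in a neighbourhood of $\lambda=0$; then $$\dot\Sigma(\rho)-\dot\Sigma(\varphi)=-\tfrac{d}{dt}S(\rho(t)\Vert\varphi(t)).$$ -/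

import Mathlib

open Filter Topology Set
open scoped ENNReal ComplexOrder InnerProductSpace

namespace EPRate

noncomputable section

/-- A Hilbert basis of `H`, used only to write down traces of positive operators (whose value does
not depend on the basis). -/
def basisSet (H : Type*) [NormedAddCommGroup H] [InnerProductSpace ℂ H] [CompleteSpace H] :
    Set H :=
  Classical.choose (exists_hilbertBasis ℂ H)

/-- The trace `∑ ⟨e, A e⟩ ∈ [0, ∞]` of a positive bounded operator `A`. -/
def posTrace {H : Type*} [NormedAddCommGroup H] [InnerProductSpace ℂ H] [CompleteSpace H]
    (A : H →L[ℂ] H) : ℝ≥0∞ :=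
  ∑' e : basisSet H, ENNReal.ofReal (RCLike.re ⟪(e : H), A (e : H)⟫_ℂ)

/-- The trace-class operators: the linear span of the positive operators of finite trace. -/
def TraceClass (H : Type*) [NormedAddCommGroup H] [InnerProductSpace ℂ H] [CompleteSpace H] :
    Submodule ℂ (H →L[ℂ] H) :=
  Submodule.span ℂ {A | 0 ≤ A ∧ posTrace A < ⊤}

/-- The set `𝓓` of states (density operators): positive operators of trace one. -/
def states (H : Type*) [NormedAddCommGroup H] [InnerProductSpace ℂ H] [CompleteSpace H] :
    Set (TraceClass H) :=
  {ρ | 0 ≤ (ρ : H →L[ℂ] H) ∧ posTrace (ρ : H →L[ℂ] H) = 1}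

/-- The trace norm `tr |A|`. -/
def traceNorm {H : Type*} [NormedAddCommGroup H] [InnerProductSpace ℂ H] [CompleteSpace H]
    (A : TraceClass H) : ℝ≥0∞ :=
  posTrace (CFC.abs (A : H →L[ℂ] H))

/-- Complete positivity of a linear map on trace-class operators: for every `n`, a positive
`n × n` block operator on `Hⁿ` with trace-class entries is sent (entrywise) to a positive one. -/
def CompletelyPositive {H : Type*} [NormedAddCommGroup H] [InnerProductSpace ℂ H]
    [CompleteSpace H] (Φ : TraceClass H →ₗ[ℂ] TraceClass H) : Prop :=
  ∀ (n : ℕ) (A : Fin n → Fin n → TraceClass H),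
    (∀ v : Fin n → H, 0 ≤ ∑ i, ∑ j, ⟪v i, (A i j : H →L[ℂ] H) (v j)⟫_ℂ) →
    ∀ v : Fin n → H, 0 ≤ ∑ i, ∑ j, ⟪v i, (Φ (A i j) : H →L[ℂ] H) (v j)⟫_ℂ

/-- Lindblad dynamics `T t = e^{t𝓛}`, `t ≥ 0`: a quantum dynamical semigroup, that is, a strongly
continuous one-parameter semigroup of completely positive trace-preserving linear maps on the
trace-class operators. The values at negative times carry no meaning. -/
structure QuantumDynamicalSemigroup (H : Type*) [NormedAddCommGroup H] [InnerProductSpace ℂ H]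
    [CompleteSpace H] where
  /-- the map `e^{t𝓛}` -/
  map : ℝ → TraceClass H →ₗ[ℂ] TraceClass H
  map_zero : map 0 = LinearMap.id
  map_add : ∀ s t : ℝ, 0 ≤ s → 0 ≤ t → map (s + t) = map s ∘ₗ map t
  completelyPositive : ∀ t : ℝ, 0 ≤ t → CompletelyPositive (map t)
  trace_map : ∀ t : ℝ, 0 ≤ t → ∀ A : TraceClass H, 0 ≤ (A : H →L[ℂ] H) →
    posTrace (map t A : H →L[ℂ] H) = posTrace (A : H →L[ℂ] H)
  continuous : ∀ A : TraceClass H,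
    Tendsto (fun t : ℝ => traceNorm (map t A - A)) (𝓝[>] 0) (𝓝 0)

/-- The von Neumann entropy `S(ρ) = -tr (ρ ln ρ) ∈ [0, ∞]`; the function `x ↦ -x ln x` is
continuous and nonnegative on the spectrum of a state. -/
def entropy {H : Type*} [NormedAddCommGroup H] [InnerProductSpace ℂ H] [CompleteSpace H]
    (ρ : TraceClass H) : ℝ≥0∞ :=
  posTrace (cfc Real.negMulLog (ρ : H →L[ℂ] H))

/-- The orthogonal projection onto the eigenspace of `A` for the real number `p`. -/
def eigenProj {H : Type*} [NormedAddCommGroup H] [InnerProductSpace ℂ H] [CompleteSpace H]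
    (A : H →L[ℂ] H) (p : ℝ) : H →L[ℂ] H :=
  (A - (p : ℂ) • (1 : H →L[ℂ] H)).ker.starProjection

/-- The relative entropy `S(ρ‖φ) = tr (ρ (ln ρ - ln φ)) ∈ [0, ∞]` of two states, equal to `∞`
unless `supp ρ ⊆ supp φ`. With the spectral resolutions `ρ = ∑ p P_p`, `φ = ∑ q R_q`, the trace is
`∑_{p,q} tr (P_p R_q) (p ln p - p ln q + q - p)`; the summands are nonnegative and the terms
`q - p`, which add up to `tr φ - tr ρ = 0`, make the sum meaningful in infinite dimension. -/
def relEntropy {H : Type*} [NormedAddCommGroup H] [InnerProductSpace ℂ H] [CompleteSpace H]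
    (ρ φ : TraceClass H) : ℝ≥0∞ :=
  open Classical in
  if (φ : H →L[ℂ] H).ker ≤ (ρ : H →L[ℂ] H).ker then
    ∑' p : ℝ, ∑' q : ℝ,
      posTrace (eigenProj (ρ : H →L[ℂ] H) p * eigenProj (φ : H →L[ℂ] H) q *
        eigenProj (ρ : H →L[ℂ] H) p) *
        ENNReal.ofReal (p * Real.log p - p * Real.log q + q - p)
  else ⊤

/-- A linear functional `𝓓 → ℝ ∪ {∞}` on the convex set of states. -/
structure IsLinearOnStates {H : Type*} [NormedAddCommGroup H] [InnerProductSpace ℂ H]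
    [CompleteSpace H] (Q : TraceClass H → EReal) : Prop where
  ne_bot : ∀ ω ∈ states H, Q ω ≠ ⊥
  map_mix : ∀ ω ∈ states H, ∀ ω' ∈ states H, ∀ c : ℝ, 0 ≤ c → c ≤ 1 →
    Q ((1 - c) • ω + c • ω') = ((1 - c : ℝ) : EReal) * Q ω + (c : EReal) * Q ω'

/-- The linear mixture `φ(c) = (1 - c) φ + c ρ`, `c ∈ ℝ`. -/
def mix {H : Type*} [NormedAddCommGroup H] [InnerProductSpace ℂ H] [CompleteSpace H]
    (φ ρ : TraceClass H) (c : ℝ) : TraceClass H :=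
  (1 - c) • φ + c • ρ

/-- The difference quotient `(S(e^{t𝓛} ω) - S(ω)) / t`. -/
def entropyQuotient {H : Type*} [NormedAddCommGroup H] [InnerProductSpace ℂ H] [CompleteSpace H]
    (T : QuantumDynamicalSemigroup H) (ω : TraceClass H) (t : ℝ) : EReal :=
  ((entropy (T.map t ω) : EReal) - (entropy ω : EReal)) / (t : EReal)

/-- The rate `d/dt S(ω(t))` at `t = 0⁺`, with values in `[-∞, ∞]`. It is written as a `limsup` so
as to be defined for every state; it is the limit of the difference quotient whenever that limit
exists. States of infinite entropy get the value `∞`. -/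
def entropyRate {H : Type*} [NormedAddCommGroup H] [InnerProductSpace ℂ H] [CompleteSpace H]
    (T : QuantumDynamicalSemigroup H) (ω : TraceClass H) : EReal :=
  open Classical in
  if entropy ω = ⊤ then ⊤ else limsup (entropyQuotient T ω) (𝓝[>] 0)

/-- The entropy production rate `Σ̇(ω) = d/dt S(ω(t)) + Q̇(ω)`. -/
def epRate {H : Type*} [NormedAddCommGroup H] [InnerProductSpace ℂ H] [CompleteSpace H]
    (T : QuantumDynamicalSemigroup H) (Q : TraceClass H → EReal) (ω : TraceClass H) : EReal :=
  entropyRate T ω + Q ω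

/-- `Σ̇(ω)` is finite: `S(ω)` and `Q̇(ω)` are finite, and the derivative `d/dt S(ω(t))` at `t = 0⁺`
exists as a real number. -/
def HasFiniteEPRate {H : Type*} [NormedAddCommGroup H] [InnerProductSpace ℂ H] [CompleteSpace H]
    (T : QuantumDynamicalSemigroup H) (Q : TraceClass H → EReal) (ω : TraceClass H) : Prop :=
  entropy ω ≠ ⊤ ∧ Q ω ≠ ⊤ ∧ ∃ r : ℝ, Tendsto (entropyQuotient T ω) (𝓝[>] 0) (𝓝 (r : EReal))

/-- The integrated entropy production `Σ(ω, t) = ∫₀ᵗ Σ̇(e^{s𝓛} ω) ds`. -/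
def integratedEP {H : Type*} [NormedAddCommGroup H] [InnerProductSpace ℂ H] [CompleteSpace H]
    (T : QuantumDynamicalSemigroup H) (Q : TraceClass H → EReal) (ω : TraceClass H) (t : ℝ) : ℝ :=
  ∫ s in (0 : ℝ)..t, (epRate T Q (T.map s ω)).toReal

/-- Regularity in time on `[0, τ]`, under which `Σ(ω, t)` is well defined, equals
`S(e^{t𝓛} ω) - S(ω) + ∫₀ᵗ Q̇(e^{s𝓛} ω) ds`, and has time derivative `Σ̇(ω)` at `0⁺` if `Σ̇(ω)` is
finite: along the trajectory of `ω`, the entropy is finite and absolutely continuous and the entropy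
flow rate is finite and continuous. -/
structure TimeRegular {H : Type*} [NormedAddCommGroup H] [InnerProductSpace ℂ H]
    [CompleteSpace H] (T : QuantumDynamicalSemigroup H) (Q : TraceClass H → EReal) (τ : ℝ)
    (ω : TraceClass H) : Prop where
  entropy_ne_top : ∀ t ∈ Icc 0 τ, entropy (T.map t ω) ≠ ⊤
  entropy_ac : AbsolutelyContinuousOnInterval (fun t => (entropy (T.map t ω)).toReal) 0 τ
  flow_ne_top : ∀ t ∈ Icc 0 τ, Q (T.map t ω) ≠ ⊤
  flow_continuous : ContinuousOn (fun t => (Q (T.map t ω)).toReal) (Icc 0 τ)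

/-- Symmetry of the one-sided partial derivatives at `c = 0`, `t = 0`:
`∂_c⁺ Σ̇(φ(c)) = ∂_t⁺ ∂_c⁺ ∫₀ᵗ Σ̇(e^{s𝓛} φ(c)) ds` (all derivatives existing; `g t` is the inner
derivative `∂_c⁺` at `c = 0`). -/
def SymmetricPartials {H : Type*} [NormedAddCommGroup H] [InnerProductSpace ℂ H]
    [CompleteSpace H] (T : QuantumDynamicalSemigroup H) (Q : TraceClass H → EReal)
    (φ ρ : TraceClass H) : Prop :=
  ∃ (d : ℝ) (g : ℝ → ℝ),
    (∀ᶠ c in 𝓝[≥] (0 : ℝ), epRate T Q (mix φ ρ c) ≠ ⊤ ∧ epRate T Q (mix φ ρ c) ≠ ⊥) ∧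
    HasDerivWithinAt (fun c => (epRate T Q (mix φ ρ c)).toReal) d (Ici 0) 0 ∧
    (∀ᶠ t in 𝓝[≥] (0 : ℝ),
      HasDerivWithinAt (fun c => integratedEP T Q (mix φ ρ c) t) (g t) (Ici 0) 0) ∧
    HasDerivWithinAt g d (Ici 0) 0

/-- If `φ ≥ α ρ` for some `α > 0`, then `c ↦ Σ̇(φ(c))` is finite and continuously differentiable in
a neighbourhood of `c = 0`. -/
def SmoothNearMinimizer {H : Type*} [NormedAddCommGroup H] [InnerProductSpace ℂ H]
    [CompleteSpace H] (T : QuantumDynamicalSemigroup H) (Q : TraceClass H → EReal)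
    (φ ρ : TraceClass H) : Prop :=
  (∃ α : ℝ, 0 < α ∧ α • (ρ : H →L[ℂ] H) ≤ (φ : H →L[ℂ] H)) →
    ∃ ε : ℝ, 0 < ε ∧
      (∀ c ∈ Ioo (-ε) ε, epRate T Q (mix φ ρ c) ≠ ⊤ ∧ epRate T Q (mix φ ρ c) ≠ ⊥) ∧
      ContDiffOn ℝ 1 (fun c => (epRate T Q (mix φ ρ c)).toReal) (Ioo (-ε) ε)

end

end EPRate

namespace EPRate

set_option linter.unusedSectionVars false

universe u

variable {H : Type*} [NormedAddCommGroup H] [InnerProductSpace ℂ H] [CompleteSpace H]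

/-! ### The Parseval identity and the trace -/

/-! Write `X(ω, σ) = -tr (ω ln σ)` for the cross entropy, so that `X(ω, σ) = S(ω) + S(ω‖σ)`
(`entropy_add_relEntropy`). It is affine in `ω`, lower semicontinuous in `σ`, equal to `S(ω)` at `σ
= ω`, and at least `S(ω)` by Klein's inequality. Testing `S(φ(c)) = X(φ(c), φ(c))` against these
facts gives `(1 - c) S(φ) + c X(ρ, φ(c)) ≤ S(φ(c)) ≤ (1 - c) S(φ) + c X(ρ, φ)`, hence the right
derivative of `S(φ(c))` at `c = 0` is `S(ρ‖φ) + S(ρ) - S(φ)` (`hasDerivWithinAt_entropy_mix`).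
Conversely, a finite right derivative forces `X(ρ, φ) < ∞`.

The integrated entropy production is the entropy change plus the integrated flow, and the flow is
affine in `c`. Differentiating in `c` at times `0` and `t` gives, with `Σ(ω, t)` the integrated
production, `g t = S(ρ(t)‖φ(t)) - S(ρ‖φ) + Σ(ρ, t) - Σ(φ, t)` (`relEntropy_map_eq`). Taking `∂_t⁺`
at `0`, the symmetry of the partial derivatives yields `d = D + Σ̇(ρ) - Σ̇(φ)`, where `d = ∂_c⁺
Σ̇(φ(c))`. Minimality of `φ` gives `d ≥ 0`; if the segment extends to some `c < 0` and `Σ̇` is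
smooth there, the minimum is interior and `d = 0`.

The operator theory before this serves to compute all traces as sums over eigenbases. -/

theorem tsum_enorm_inner_sq {ι : Type*} (b : HilbertBasis ι ℂ H) (x : H) :
    ∑' i, ‖⟪b i, x⟫_ℂ‖ₑ ^ 2 = ‖x‖ₑ ^ 2 := by
  have h := b.hasSum_inner_mul_inner x x
  have h2 : HasSum (fun i => ‖⟪b i, x⟫_ℂ‖ ^ 2) (‖x‖ ^ 2) := by
    have := (Complex.hasSum_re h)
    convert this using 1
    · funext i
      rw [← inner_conj_symm x (b i), RCLike.conj_mul]
      norm_cast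
    · rw [inner_self_eq_norm_sq_to_K]
      norm_cast
  have h3 := ENNReal.ofReal_tsum_of_nonneg (fun i => by positivity) h2.summable
  rw [h2.tsum_eq] at h3
  simp_rw [ENNReal.ofReal_pow (norm_nonneg _), ofReal_norm] at h3
  exact h3.symm

theorem enorm_inner_symm (x y : H) : ‖⟪x, y⟫_ℂ‖ₑ = ‖⟪y, x⟫_ℂ‖ₑ := by
  rw [← ofReal_norm, ← ofReal_norm, norm_inner_symm]

/-- By Parseval both sides are the double sum of `|⟨b₂ j, B (b i)⟩|²`, summed in the two orders.
Applied twice, this makes the Hilbert–Schmidt norm independent of the basis. -/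
theorem tsum_enorm_sq_adjoint {ι κ : Type*} (b : HilbertBasis ι ℂ H) (b₂ : HilbertBasis κ ℂ H)
    (B : H →L[ℂ] H) :
    ∑' i, ‖B (b i)‖ₑ ^ 2 = ∑' j, ‖ContinuousLinearMap.adjoint B (b₂ j)‖ₑ ^ 2 := by
  have h1 : ∀ i, ‖B (b i)‖ₑ ^ 2 = ∑' j, ‖⟪b₂ j, B (b i)⟫_ℂ‖ₑ ^ 2 :=
    fun i => (tsum_enorm_inner_sq b₂ _).symm
  have h2 : ∀ j, ‖ContinuousLinearMap.adjoint B (b₂ j)‖ₑ ^ 2 =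
      ∑' i, ‖⟪b i, ContinuousLinearMap.adjoint B (b₂ j)⟫_ℂ‖ₑ ^ 2 :=
    fun j => (tsum_enorm_inner_sq b _).symm
  simp_rw [h1, h2]
  rw [ENNReal.tsum_comm]
  refine tsum_congr fun j => tsum_congr fun i => ?_
  rw [ContinuousLinearMap.adjoint_inner_right, enorm_inner_symm]

theorem tsum_enorm_sq_eq {ι κ : Type*} (b : HilbertBasis ι ℂ H) (b₂ : HilbertBasis κ ℂ H)
    (B : H →L[ℂ] H) : ∑' i, ‖B (b i)‖ₑ ^ 2 = ∑' j, ‖B (b₂ j)‖ₑ ^ 2 := by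
  rw [tsum_enorm_sq_adjoint b b₂, ← tsum_enorm_sq_adjoint b₂ b₂]

/-- The quadratic form `⟨x, A x⟩` of a positive operator, as an extended nonnegative number. -/
noncomputable def quadForm (A : H →L[ℂ] H) (x : H) : ℝ≥0∞ :=
  ENNReal.ofReal (RCLike.re ⟪x, A x⟫_ℂ)

theorem isPositive_of_nonneg {A : H →L[ℂ] H} (hA : 0 ≤ A) : A.IsPositive :=
  (ContinuousLinearMap.nonneg_iff_isPositive A).1 hA

theorem re_inner_nonneg {A : H →L[ℂ] H} (hA : 0 ≤ A) (x : H) : 0 ≤ RCLike.re ⟪x, A x⟫_ℂ :=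
  (isPositive_of_nonneg hA).re_inner_nonneg_right x

theorem quadForm_eq_sqrt {A : H →L[ℂ] H} (hA : 0 ≤ A) (x : H) :
    quadForm A x = ‖CFC.sqrt A x‖ₑ ^ 2 := by
  have hs : 0 ≤ CFC.sqrt A := CFC.sqrt_nonneg A
  have h : CFC.sqrt A (CFC.sqrt A x) = A x := by
    conv_rhs => rw [← CFC.sqrt_mul_sqrt_self A hA]
    rfl
  have h2 : ⟪x, A x⟫_ℂ = ⟪CFC.sqrt A x, CFC.sqrt A x⟫_ℂ := by
    rw [← h]
    exact ((isPositive_of_nonneg hs).isSymmetric _ _).symm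
  rw [quadForm, h2, inner_self_eq_norm_sq, ENNReal.ofReal_pow (norm_nonneg _), ofReal_norm]

theorem posTrace_eq_quadForm (A : H →L[ℂ] H) :
    posTrace A = ∑' e : basisSet H, quadForm A (e : H) := rfl

theorem exists_coe_eq_basisSet : ∃ b : HilbertBasis (basisSet H) ℂ H, ⇑b = ((↑) : basisSet H → H) :=
  Classical.choose_spec (exists_hilbertBasis ℂ H)

/-- The trace of a positive operator may be computed in any Hilbert basis. -/
theorem posTrace_eq {ι : Type*} (b : HilbertBasis ι ℂ H) {A : H →L[ℂ] H} (hA : 0 ≤ A) :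
    posTrace A = ∑' i, quadForm A (b i) := by
  obtain ⟨b₀, hb₀⟩ := exists_coe_eq_basisSet (H := H)
  rw [posTrace_eq_quadForm]
  -- The trace of `A` is the squared Hilbert–Schmidt norm of `√A`.
  simp_rw [quadForm_eq_sqrt hA]
  rw [tsum_enorm_sq_eq b b₀, hb₀]

theorem quadForm_add {A B : H →L[ℂ] H} (hA : 0 ≤ A) (hB : 0 ≤ B) (x : H) :
    quadForm (A + B) x = quadForm A x + quadForm B x := by
  simp only [quadForm, add_apply, inner_add_right, map_add]
  exact ENNReal.ofReal_add (re_inner_nonneg hA x) (re_inner_nonneg hB x)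

theorem quadForm_smul (A : H →L[ℂ] H) {c : ℝ} (hc : 0 ≤ c) (x : H) :
    quadForm (c • A) x = ENNReal.ofReal c * quadForm A x := by
  have : ⟪x, (c • A) x⟫_ℂ = (c : ℂ) * ⟪x, A x⟫_ℂ := by
    rw [smul_apply, ← inner_smul_right]
    rfl
  rw [quadForm, this, quadForm, ← ENNReal.ofReal_mul hc]
  simp

theorem eq_zero_of_quadForm_eq_zero {A : H →L[ℂ] H} (hA : 0 ≤ A) {x : H} (h : quadForm A x = 0) :
    A x = 0 := by
  rw [quadForm_eq_sqrt hA] at h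
  have h1 : CFC.sqrt A x = 0 := by simpa using h
  rw [← CFC.sqrt_mul_sqrt_self A hA]
  simp [h1]

/-- The Hilbert–Schmidt norm dominates the operator norm: apply Cauchy–Schwarz to each coordinate
`⟨b i, B x⟩ = ⟨B* (b i), x⟩`. -/
theorem enorm_sq_le_tsum {ι : Type*} (b : HilbertBasis ι ℂ H) (B : H →L[ℂ] H) (x : H) :
    ‖B x‖ₑ ^ 2 ≤ (∑' i, ‖B (b i)‖ₑ ^ 2) * ‖x‖ₑ ^ 2 := by
  rw [tsum_enorm_sq_adjoint b b, ← tsum_enorm_inner_sq b (B x), ← ENNReal.tsum_mul_right]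
  refine ENNReal.tsum_le_tsum fun i => ?_
  rw [← ContinuousLinearMap.adjoint_inner_left, ← mul_pow]
  gcongr
  rw [← ofReal_norm, ← ofReal_norm, ← ofReal_norm, ← ENNReal.ofReal_mul (norm_nonneg _)]
  exact ENNReal.ofReal_le_ofReal (norm_inner_le_norm _ _)

theorem norm_le_of_tsum_le {ι : Type*} (b : HilbertBasis ι ℂ H) (B : H →L[ℂ] H) {c : ℝ}
    (hc : 0 ≤ c) (h : ∑' i, ‖B (b i)‖ₑ ^ 2 ≤ ENNReal.ofReal (c ^ 2)) : ‖B‖ ≤ c := by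
  refine B.opNorm_le_bound hc fun x => ?_
  have h1 := (enorm_sq_le_tsum b B x).trans (mul_le_mul_left h _)
  rw [ENNReal.ofReal_pow hc, ← mul_pow, ← ofReal_norm, ← ofReal_norm, ← ENNReal.ofReal_mul hc,
    ← ENNReal.ofReal_pow (by positivity), ← ENNReal.ofReal_pow (by positivity),
    ENNReal.ofReal_le_ofReal_iff (by positivity)] at h1
  exact (pow_le_pow_iff_left₀ (by positivity) (by positivity) two_ne_zero).1 h1

/-! ### Positive operators of finite trace have an eigenbasis -/

/-- `B` is the norm limit of the finite-rank operators `B ∘L P F`, since the Hilbert–Schmidt norm of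
the difference is the tail of a convergent sum. -/
theorem isCompactOperator_of_tsum_ne_top {ι : Type*} (b : HilbertBasis ι ℂ H) (B : H →L[ℂ] H)
    (h : ∑' i, ‖B (b i)‖ₑ ^ 2 ≠ ⊤) : IsCompactOperator B := by
  classical
  let P : Finset ι → H →L[ℂ] H := fun F =>
    ∑ i ∈ F, (innerSL ℂ (b i)).smulRight (b i)
  have hP : ∀ F i, P F (b i) = if i ∈ F then b i else 0 := by
    intro F i
    simp [P, orthonormal_iff_ite.1 b.orthonormal]
  have hcomp : ∀ F, IsCompactOperator (B ∘L P F) := by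
    intro F
    have : IsCompactOperator (P F) := by
      have hmem : ∀ G : Finset ι, P G ∈ compactOperator (RingHom.id ℂ) H H := by
        intro G
        refine Submodule.sum_mem _ fun i _ => ?_
        change IsCompactOperator _
        have : IsCompactOperator (innerSL ℂ (b i) : H →L[ℂ] ℂ) :=
          isCompactOperator_of_locallyCompactSpace_dom _
        exact this.clm_comp (ContinuousLinearMap.toSpanSingleton ℂ (b i))
      exact hmem F
    exact this.clm_comp B
  have hlim : Tendsto (fun F => B ∘L P F) atTop (𝓝 B) := by
    rw [tendsto_iff_norm_sub_tendsto_zero, Metric.tendsto_atTop]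
    intro ε hε
    have ht := ENNReal.tendsto_tsum_compl_atTop_zero h
    have hev := ht.eventually (gt_mem_nhds (show (0 : ℝ≥0∞) < ENNReal.ofReal ((ε / 2) ^ 2) by
      rw [ENNReal.ofReal_pos]; positivity))
    obtain ⟨F₀, hF₀⟩ := eventually_atTop.1 hev
    refine ⟨F₀, fun F hF => ?_⟩
    have hle : ‖B ∘L P F - B‖ ≤ ε / 2 := by
      refine norm_le_of_tsum_le b _ (by positivity) ?_
      refine le_trans (le_of_eq ?_) (hF₀ F hF).le
      have : ∀ i, ‖(B ∘L P F - B) (b i)‖ₑ ^ 2 =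
          ({i | i ∉ F} : Set ι).indicator (fun i => ‖B (b i)‖ₑ ^ 2) i := by
        intro i
        by_cases hi : i ∈ F <;> simp [hP, hi]
      simp_rw [this]
      exact (tsum_subtype _ _).symm
    simp only [dist_zero_right, norm_norm]
    linarith
  exact isCompactOperator_of_tendsto hlim (Eventually.of_forall hcomp)

theorem isCompactOperator_of_posTrace_ne_top {A : H →L[ℂ] H} (hA : 0 ≤ A) (h : posTrace A ≠ ⊤) :
    IsCompactOperator A := by
  obtain ⟨b₀, hb₀⟩ := exists_coe_eq_basisSet (H := H)
  rw [posTrace_eq b₀ hA] at h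
  simp_rw [quadForm_eq_sqrt hA] at h
  have := (isCompactOperator_of_tsum_ne_top b₀ _ h).clm_comp (CFC.sqrt A)
  have h2 : ⇑(CFC.sqrt A) ∘ ⇑(CFC.sqrt A) = ⇑A := by
    conv_rhs => rw [← CFC.sqrt_mul_sqrt_self A hA]
    rfl
  rwa [h2] at this

/-- `b` is a Hilbert basis of eigenvectors of `A`, with eigenvalues `p`. -/
def IsEigenbasis {ι : Type*} (A : H →L[ℂ] H) (b : HilbertBasis ι ℂ H) (p : ι → ℝ) : Prop :=
  ∀ i, A (b i) = (p i : ℂ) • b i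

/-- By the spectral theorem for compact self-adjoint operators the eigenspaces, kernel included, are
orthogonal with dense span; Hilbert bases of all of them are glued together. -/
theorem exists_isEigenbasis {H : Type u} [NormedAddCommGroup H] [InnerProductSpace ℂ H]
    [CompleteSpace H] {A : H →L[ℂ] H} (hA : 0 ≤ A) (h : posTrace A ≠ ⊤) :
    ∃ (ι : Type u) (b : HilbertBasis ι ℂ H) (p : ι → ℝ), IsEigenbasis A b p := by
  have hsymm := (isPositive_of_nonneg hA).isSymmetric
  have hcompact := isCompactOperator_of_posTrace_ne_top hA h
  let E : ℂ → Submodule ℂ H := fun μ => Module.End.eigenspace (A : H →ₗ[ℂ] H) μ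
  have hclosed : ∀ μ, CompleteSpace (E μ) := by
    intro μ
    have : IsClosed (E μ : Set H) := by
      have : (E μ : Set H) = {x | A x = μ • x} := by
        ext x
        exact Module.End.mem_eigenspace_iff
      rw [this]
      exact isClosed_eq A.continuous (continuous_const_smul μ)
    exact this.completeSpace_coe
  choose w b hb using fun μ => exists_hilbertBasis ℂ (E μ)
  let v : (Σ μ, w μ) → H := fun i => ((i.2 : E i.1) : H)
  have hv : Orthonormal ℂ v := by
    refine hsymm.orthogonalFamily_eigenspaces.orthonormal_sigma_orthonormal
      (v_family := fun μ (i : w μ) => (i : E μ)) fun μ => ?_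
    rw [← hb μ]
    exact (b μ).orthonormal
  have hspan : (Submodule.span ℂ (range v))ᗮ = ⊥ := by
    rw [eq_bot_iff,
      ← ContinuousLinearMap.orthogonalComplement_iSup_eigenspaces_eq_bot hcompact hsymm,
      ← Submodule.iInf_orthogonal]
    refine le_iInf fun μ => ?_
    intro x hx
    rw [Submodule.mem_orthogonal'] at hx ⊢
    intro y hy
    have hs := ((b μ).hasSum_repr ⟨y, hy⟩).mapL ((innerSL ℂ x).comp (E μ).subtypeL)
    have hz : ∀ i, ((innerSL ℂ x).comp (E μ).subtypeL)
        ((b μ).repr ⟨y, hy⟩ i • (b μ) i) = 0 := by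
      intro i
      rw [map_smul, hb μ]
      have := hx (v ⟨μ, i⟩) (Submodule.subset_span ⟨_, rfl⟩)
      simp only [ContinuousLinearMap.comp_apply, Submodule.subtypeL_apply, innerSL_apply_apply]
      rw [this, smul_zero]
    simp_rw [hz] at hs
    exact hs.unique hasSum_zero
  refine ⟨_, HilbertBasis.mkOfOrthogonalEqBot hv hspan, fun i => i.1.re, fun i => ?_⟩
  rw [HilbertBasis.coe_mkOfOrthogonalEqBot]
  have hmem : A (v i) = i.1 • v i := Module.End.mem_eigenspace_iff.1 (i.2 : E i.1).2
  have hne : v i ≠ 0 := hv.ne_zero i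
  have hreal := hsymm.conj_eigenvalue_eq_self
    (Module.End.hasEigenvalue_of_hasEigenvector ⟨(i.2 : E i.1).2, hne⟩)
  rw [hmem]
  congr 1
  exact (Complex.conj_eq_iff_re.1 hreal).symm

/-! ### Positive operators in the coordinates of an eigenbasis. -/

namespace IsEigenbasis

variable {ι : Type*} {A : H →L[ℂ] H} {b : HilbertBasis ι ℂ H} {p : ι → ℝ}

theorem quadForm_apply (h : IsEigenbasis A b p) (i : ι) :
    quadForm A (b i) = ENNReal.ofReal (p i) := by
  rw [quadForm, h i, inner_smul_right, inner_self_eq_norm_sq_to_K, b.orthonormal.1 i]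
  simp

theorem nonneg (h : IsEigenbasis A b p) (hA : 0 ≤ A) (i : ι) : 0 ≤ p i := by
  have := re_inner_nonneg hA (b i)
  rw [h i, inner_smul_right, inner_self_eq_norm_sq_to_K, b.orthonormal.1 i] at this
  simpa using this

theorem tsum_eq_posTrace (h : IsEigenbasis A b p) (hA : 0 ≤ A) :
    ∑' i, ENNReal.ofReal (p i) = posTrace A := by
  rw [posTrace_eq b hA]
  exact tsum_congr fun i => (h.quadForm_apply i).symm

theorem le_one (h : IsEigenbasis A b p) (hA : 0 ≤ A) (htr : posTrace A = 1) (i : ι) :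
    p i ≤ 1 := by
  rw [← ENNReal.ofReal_le_one, ← htr, ← h.tsum_eq_posTrace hA]
  exact ENNReal.le_tsum i

theorem inner_apply (h : IsEigenbasis A b p) (hA : 0 ≤ A) (i : ι) (x : H) :
    ⟪b i, A x⟫_ℂ = (p i : ℂ) * ⟪b i, x⟫_ℂ := by
  rw [← ContinuousLinearMap.coe_coe, ← (isPositive_of_nonneg hA).isSymmetric (b i) x,
    ContinuousLinearMap.coe_coe, h i, inner_smul_left]
  simp

theorem quadForm_eq_tsum (h : IsEigenbasis A b p) (hA : 0 ≤ A) (x : H) :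
    quadForm A x = ∑' i, ENNReal.ofReal (p i) * ‖⟪b i, x⟫_ℂ‖ₑ ^ 2 := by
  have h2 : HasSum (fun i => p i * ‖⟪b i, x⟫_ℂ‖ ^ 2) (RCLike.re ⟪x, A x⟫_ℂ) := by
    have hre := Complex.hasSum_re (b.hasSum_inner_mul_inner x (A x))
    refine hre.congr_fun fun i => ?_
    rw [h.inner_apply hA, ← inner_conj_symm x (b i), mul_left_comm, RCLike.conj_mul,
      Complex.re_ofReal_mul]
    norm_cast
  have h0 := h.nonneg hA
  rw [quadForm, ← h2.tsum_eq,
    ENNReal.ofReal_tsum_of_nonneg (fun i => mul_nonneg (h0 i) (by positivity)) h2.summable]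
  refine tsum_congr fun i => ?_
  rw [ENNReal.ofReal_mul (h0 i), ENNReal.ofReal_pow (norm_nonneg _), ofReal_norm]

theorem eigenProj_apply (h : IsEigenbasis A b p) (hA : 0 ≤ A) (q : ℝ) (i : ι) :
    eigenProj A q (b i) = if p i = q then b i else 0 := by
  rw [eigenProj]
  split_ifs with hi
  · rw [Submodule.starProjection_eq_self_iff]
    change (A - (q : ℂ) • (1 : H →L[ℂ] H)) (b i) = 0
    simp [h i, hi]
  · rw [Submodule.starProjection_apply_eq_zero_iff]
    rw [Submodule.mem_orthogonal']
    intro y hy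
    have hy' : A y = (q : ℂ) • y := by
      have : (A - (q : ℂ) • (1 : H →L[ℂ] H)) y = 0 := hy
      simpa [sub_eq_zero] using this
    have h1 := h.inner_apply hA i y
    rw [hy', inner_smul_right] at h1
    by_contra hne
    exact hi (by exact_mod_cast (mul_right_cancel₀ hne h1).symm)

theorem inner_eigenProj (h : IsEigenbasis A b p) (hA : 0 ≤ A) (q : ℝ) (i : ι) (x : H) :
    ⟪b i, eigenProj A q x⟫_ℂ = if p i = q then ⟪b i, x⟫_ℂ else 0 := by
  have : ⟪b i, eigenProj A q x⟫_ℂ = ⟪eigenProj A q (b i), x⟫_ℂ :=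
    (Submodule.inner_starProjection_left_eq_right _ _ _).symm
  rw [this, h.eigenProj_apply hA]
  split_ifs <;> simp

end IsEigenbasis

/-! ### Functional calculus on eigenvectors. -/

/-- The identity holds for constants and for the coordinate function, survives sums and products,
and is closed under uniform limits, so Stone–Weierstrass gives it for every continuous function on
the spectrum. -/
theorem cfc_apply_eigenvector {A : H →L[ℂ] H} (hA : IsSelfAdjoint A) {f : ℝ → ℝ}
    (hf : ContinuousOn f (spectrum ℝ A)) {q : ℝ} {v : H} (hv : A v = (q : ℂ) • v) :
    cfc f A v = ((f q : ℝ) : ℂ) • v := by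
  by_cases hv0 : v = 0
  · simp [hv0]
  have hq : q ∈ spectrum ℝ A := by
    intro hu
    obtain ⟨u, hu⟩ := hu
    have h1 : (u : H →L[ℂ] H) v = 0 := by
      rw [hu]
      simp [hv, Algebra.algebraMap_eq_smul_one]
    apply hv0
    have : (↑u⁻¹ * (u : H →L[ℂ] H)) v = v := by simp
    rw [← this, mul_apply_eq_comp, h1, map_zero]
  rw [cfc_apply f A hA hf]
  have key : ∀ g : C(spectrum ℝ A, ℝ), cfcHom hA g v = ((g ⟨q, hq⟩ : ℝ) : ℂ) • v := by
    intro g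
    induction g using ContinuousMap.induction_on_of_compact with
    | const r =>
      have : ContinuousMap.const (spectrum ℝ A) r = algebraMap ℝ _ r := rfl
      rw [this, AlgHomClass.commutes]
      simp [Algebra.algebraMap_eq_smul_one]
    | id =>
      rw [cfcHom_id]
      simpa using hv
    | star_id =>
      rw [star_trivial, cfcHom_id]
      simpa using hv
    | add f g hf hg => simp [hf, hg, add_smul]
    | mul f g hf hg => 
      rw [map_mul, mul_apply_eq_comp, hg, map_smul, hf, smul_smul,
        ContinuousMap.mul_apply, Complex.ofReal_mul, mul_comm]
    | frequently f hf =>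
      have hc1 : Continuous fun g : C(spectrum ℝ A, ℝ) => cfcHom hA g v :=
        ((ContinuousLinearMap.apply ℂ H v).continuous.comp (cfcHom_continuous hA))
      have hc2 : Continuous fun g : C(spectrum ℝ A, ℝ) => ((g ⟨q, hq⟩ : ℝ) : ℂ) • v := by
        fun_prop
      have hcl := isClosed_eq hc1 hc2
      exact hcl.closure_subset (mem_closure_iff_frequently.2 hf)
  exact key _

/-! ### Density operators and their entropy -/

/-- A density operator: a positive operator of trace one. -/
def IsDensity (A : H →L[ℂ] H) : Prop := 0 ≤ A ∧ posTrace A = 1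

/-- Trace one means that `√A` has Hilbert–Schmidt norm one, so `‖A‖ ≤ ‖√A‖² ≤ 1`. -/
theorem IsDensity.spectrum_subset {A : H →L[ℂ] H} (hA : IsDensity A) :
    spectrum ℝ A ⊆ Icc 0 1 := by
  intro x hx
  refine ⟨spectrum_nonneg_of_nonneg hA.1 hx, ?_⟩
  obtain ⟨b₀, -⟩ := exists_coe_eq_basisSet (H := H)
  have hs : ‖CFC.sqrt A‖ ≤ 1 := by
    refine norm_le_of_tsum_le b₀ _ zero_le_one ?_
    simp_rw [← quadForm_eq_sqrt hA.1]
    rw [← posTrace_eq b₀ hA.1, hA.2]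
    simp
  have hn : ‖A‖ ≤ 1 := by
    rw [← CFC.sqrt_mul_sqrt_self A hA.1]
    exact (norm_mul_le _ _).trans (mul_le_one₀ hs (norm_nonneg _) hs)
  have h1 := spectrum.norm_le_norm_mul_of_mem hx
  have h2 : ‖(1 : H →L[ℂ] H)‖ ≤ 1 := ContinuousLinearMap.norm_id_le
  calc x ≤ ‖x‖ := Real.le_norm_self x
    _ ≤ ‖A‖ * ‖(1 : H →L[ℂ] H)‖ := h1
    _ ≤ 1 := mul_le_one₀ hn (norm_nonneg _) h2

theorem IsDensity.exists_isEigenbasis {H : Type u} [NormedAddCommGroup H] [InnerProductSpace ℂ H]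
    [CompleteSpace H] {A : H →L[ℂ] H} (hA : IsDensity A) :
    ∃ (ι : Type u) (b : HilbertBasis ι ℂ H) (p : ι → ℝ), IsEigenbasis A b p :=
  EPRate.exists_isEigenbasis hA.1 (by simp [hA.2])

theorem IsEigenbasis.cfc {ι : Type*} {A : H →L[ℂ] H} {b : HilbertBasis ι ℂ H} {p : ι → ℝ}
    (h : IsEigenbasis A b p) (hA : 0 ≤ A) {f : ℝ → ℝ} (hf : Continuous f) :
    IsEigenbasis (cfc f A) b (f ∘ p) :=
  fun i => cfc_apply_eigenvector (IsSelfAdjoint.of_nonneg hA) hf.continuousOn (h i)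

theorem IsEigenbasis.posTrace_negMulLog {ι : Type*} {A : H →L[ℂ] H} {b : HilbertBasis ι ℂ H}
    {p : ι → ℝ} (h : IsEigenbasis A b p) (hA : IsDensity A) :
    posTrace (_root_.cfc Real.negMulLog A) = ∑' i, ENNReal.ofReal (Real.negMulLog (p i)) := by
  have hpos : 0 ≤ _root_.cfc Real.negMulLog A := cfc_nonneg fun x hx =>
    Real.negMulLog_nonneg (hA.spectrum_subset hx).1 (hA.spectrum_subset hx).2
  exact ((h.cfc hA.1 Real.continuous_negMulLog).tsum_eq_posTrace hpos).symm

/-! ### The cross entropy `-tr (ω ln φ)` -/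

/-- The function `-ln x` on `[0, 1]`, with value `∞` at `0`. -/
noncomputable def negLog (x : ℝ) : ℝ≥0∞ := if x ≤ 0 then ⊤ else ENNReal.ofReal (-Real.log x)

/-- The square root of `-ln x` on `[0, 1]`, cut off near `0`. -/
noncomputable def sqrtNegLog (n : ℕ) (x : ℝ) : ℝ := √(-Real.log (max x (1 / ((n : ℝ) + 1))))

theorem continuous_sqrtNegLog (n : ℕ) : Continuous (sqrtNegLog n) := by
  have hpos : (0 : ℝ) < 1 / ((n : ℝ) + 1) := by positivity
  refine Real.continuous_sqrt.comp (Continuous.neg (Continuous.log (by fun_prop) fun x => ?_))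
  exact (lt_of_lt_of_le hpos (le_max_right _ _)).ne'

theorem sqrtNegLog_sq (n : ℕ) {x : ℝ} (hx : x ≤ 1) :
    sqrtNegLog n x ^ 2 = -Real.log (max x (1 / ((n : ℝ) + 1))) := by
  refine Real.sq_sqrt ?_
  have hpos : (0 : ℝ) < 1 / ((n : ℝ) + 1) := by positivity
  have h1 : (1 : ℝ) / ((n : ℝ) + 1) ≤ 1 := by
    rw [div_le_one (by positivity)]
    linarith [n.cast_nonneg (α := ℝ)]
  have := Real.log_nonpos (le_trans hpos.le (le_max_right x _)) (max_le hx h1)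
  linarith

theorem monotone_sqrtNegLog_sq {x : ℝ} (hx : x ≤ 1) :
    Monotone fun n => ENNReal.ofReal (sqrtNegLog n x ^ 2) := by
  intro m n hmn
  simp only [sqrtNegLog_sq _ hx]
  apply ENNReal.ofReal_le_ofReal
  have hpos : (0 : ℝ) < 1 / ((n : ℝ) + 1) := by positivity
  have : (1 : ℝ) / ((n : ℝ) + 1) ≤ 1 / ((m : ℝ) + 1) := Nat.one_div_le_one_div hmn
  have := Real.log_le_log (lt_of_lt_of_le hpos (le_max_right x _)) (max_le_max_left x this)
  linarith

theorem iSup_sqrtNegLog_sq {x : ℝ} (hx : x ≤ 1) :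
    ⨆ n, ENNReal.ofReal (sqrtNegLog n x ^ 2) = negLog x := by
  refine iSup_eq_of_tendsto (monotone_sqrtNegLog_sq hx) ?_
  simp only [sqrtNegLog_sq _ hx]
  rw [negLog]
  split_ifs with h0
  · refine ENNReal.tendsto_ofReal_atTop.comp ?_
    have : ∀ n : ℕ, -Real.log (max x (1 / ((n : ℝ) + 1))) = Real.log ((n : ℝ) + 1) := by
      intro n
      have hpos : (0 : ℝ) < 1 / ((n : ℝ) + 1) := by positivity
      rw [max_eq_right (h0.trans hpos.le), one_div, Real.log_inv, neg_neg]
    simp_rw [this]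
    exact Real.tendsto_log_atTop.comp
      (tendsto_atTop_add_const_right _ _ tendsto_natCast_atTop_atTop)
  · refine tendsto_const_nhds.congr' ?_
    filter_upwards [tendsto_one_div_add_atTop_nhds_zero_nat.eventually
      (gt_mem_nhds (not_le.1 h0))] with n hn
    rw [max_eq_left hn.le]

theorem tsum_iSup_of_monotone {ι : Type*} {f : ι → ℕ → ℝ≥0∞} (hf : ∀ i, Monotone (f i)) :
    ∑' i, ⨆ n, f i n = ⨆ n, ∑' i, f i n := by
  simp_rw [ENNReal.tsum_eq_iSup_sum]
  rw [iSup_comm]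
  exact iSup_congr fun s => ENNReal.finsetSum_iSup_of_monotone hf

/-- The cross entropy `-tr (ω ln φ)` of density operators, as a limit over cut-offs of the
logarithm. -/
noncomputable def crossEntropy (ω φ : H →L[ℂ] H) : ℝ≥0∞ :=
  ⨆ n, posTrace (cfc (sqrtNegLog n) φ * ω * cfc (sqrtNegLog n) φ)

section

variable {ι κ : Type*} {ω φ : H →L[ℂ] H} {e : HilbertBasis ι ℂ H} {f : HilbertBasis κ ℂ H}
  {p : ι → ℝ} {q : κ → ℝ}

/-- The cut-off logarithm enters `crossEntropy` through its square root on both sides of `ω`, so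
that the operator traced is positive; in an eigenbasis of `φ` the two factors come out as a scalar.
-/
theorem IsEigenbasis.quadForm_conj (hf : IsEigenbasis φ f q) (hφ : 0 ≤ φ) (g : ℝ → ℝ)
    (hg : Continuous g) (ω : H →L[ℂ] H) (j : κ) :
    quadForm (_root_.cfc g φ * ω * _root_.cfc g φ) (f j) =
      ENNReal.ofReal (g (q j) ^ 2) * quadForm ω (f j) := by
  have h1 := hf.cfc hφ hg j
  have hsa : IsSelfAdjoint (_root_.cfc g φ) := cfc_predicate g φ
  have h2 : ⟪f j, (_root_.cfc g φ * ω * _root_.cfc g φ) (f j)⟫_ℂ =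
      ((g (q j) ^ 2 : ℝ) : ℂ) * ⟪f j, ω (f j)⟫_ℂ := by
    rw [mul_apply_eq_comp, mul_apply_eq_comp, ← ContinuousLinearMap.adjoint_inner_left,
      ← ContinuousLinearMap.star_eq_adjoint, hsa.star_eq, h1, map_smul, inner_smul_left,
      inner_smul_right]
    simp
    ring
  rw [quadForm, h2, quadForm, ← ENNReal.ofReal_mul (by positivity)]
  simp [-Complex.ofReal_pow]

theorem conj_cfc_nonneg (hω : 0 ≤ ω) (g : ℝ → ℝ) (φ : H →L[ℂ] H) :
    0 ≤ cfc g φ * ω * cfc g φ :=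
  IsSelfAdjoint.conjugate_nonneg hω (cfc_predicate g φ)

/-- The cut-offs increase to `negLog`, so monotone convergence moves the supremum inside the trace.
The convention `0 * ⊤ = 0` discards kernel vectors of `φ` that `ω` does not see. -/
theorem crossEntropy_eq_tsum (hf : IsEigenbasis φ f q) (hφ : IsDensity φ) (hω : 0 ≤ ω) :
    crossEntropy ω φ = ∑' j, quadForm ω (f j) * negLog (q j) := by
  simp_rw [← iSup_sqrtNegLog_sq (hf.le_one hφ.1 hφ.2 _), ENNReal.mul_iSup]
  rw [tsum_iSup_of_monotone fun j => (monotone_sqrtNegLog_sq (hf.le_one hφ.1 hφ.2 j)).const_mul' _]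
  refine iSup_congr fun n => ?_
  rw [posTrace_eq f (conj_cfc_nonneg hω _ φ)]
  refine tsum_congr fun j => ?_
  rw [hf.quadForm_conj hφ.1 _ (continuous_sqrtNegLog n), mul_comm]

theorem ofReal_mul_negLog {x : ℝ} (h0 : 0 ≤ x) :
    ENNReal.ofReal x * negLog x = ENNReal.ofReal (Real.negMulLog x) := by
  rcases h0.eq_or_lt with rfl | h
  · simp
  · rw [negLog, if_neg h.not_ge, ← ENNReal.ofReal_mul h0, Real.negMulLog]
    congr 1
    ring

theorem crossEntropy_self (hω : IsDensity ω) :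
    crossEntropy ω ω = posTrace (cfc Real.negMulLog ω) := by
  obtain ⟨ι, e, p, he⟩ := hω.exists_isEigenbasis
  rw [crossEntropy_eq_tsum he hω hω.1, he.posTrace_negMulLog hω]
  refine tsum_congr fun i => ?_
  rw [he.quadForm_apply, ofReal_mul_negLog (he.nonneg hω.1 i)]

theorem crossEntropy_combo {ω' : H →L[ℂ] H} (hφ : IsDensity φ) (hω : 0 ≤ ω) (hω' : 0 ≤ ω')
    {a b : ℝ} (ha : 0 ≤ a) (hb : 0 ≤ b) :
    crossEntropy (a • ω + b • ω') φ =
      ENNReal.ofReal a * crossEntropy ω φ + ENNReal.ofReal b * crossEntropy ω' φ := by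
  obtain ⟨κ, f, q, hf⟩ := hφ.exists_isEigenbasis
  have h1 : 0 ≤ a • ω := smul_nonneg ha hω
  have h2 : 0 ≤ b • ω' := smul_nonneg hb hω'
  rw [crossEntropy_eq_tsum hf hφ (add_nonneg h1 h2), crossEntropy_eq_tsum hf hφ hω,
    crossEntropy_eq_tsum hf hφ hω', ← ENNReal.tsum_mul_left, ← ENNReal.tsum_mul_left,
    ← ENNReal.tsum_add]
  refine tsum_congr fun j => ?_
  rw [quadForm_add h1 h2, quadForm_smul _ ha, quadForm_smul _ hb]
  ring

/-! ### Relative entropy and cross entropy -/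

theorem eigenProj_isSelfAdjoint (A : H →L[ℂ] H) (r : ℝ) : IsSelfAdjoint (eigenProj A r) :=
  isSelfAdjoint_starProjection _

theorem eigenProj_nonneg (A : H →L[ℂ] H) (r : ℝ) : 0 ≤ eigenProj A r :=
  (ContinuousLinearMap.nonneg_iff_isPositive _).2 
    (ContinuousLinearMap.IsPositive.of_isStarProjection isStarProjection_starProjection)

theorem quadForm_eigenProj (hf : IsEigenbasis φ f q) (hφ : 0 ≤ φ) (s : ℝ) (x : H) :
    quadForm (eigenProj φ s) x = ∑' j, if q j = s then ‖⟪f j, x⟫_ℂ‖ₑ ^ 2 else 0 := by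
  have h1 : ⟪x, eigenProj φ s x⟫_ℂ = ⟪eigenProj φ s x, eigenProj φ s x⟫_ℂ := by
    have hidem : eigenProj φ s (eigenProj φ s x) = eigenProj φ s x := by
      rw [eigenProj, Submodule.starProjection_eq_self_iff]
      exact Submodule.starProjection_apply_mem _ _
    conv_lhs => rw [← hidem]
    exact (Submodule.inner_starProjection_left_eq_right _ _ _).symm
  rw [quadForm, h1, inner_self_eq_norm_sq, ENNReal.ofReal_pow (norm_nonneg _), ofReal_norm,
    ← tsum_enorm_inner_sq f]
  refine tsum_congr fun j => ?_
  rw [hf.inner_eigenProj hφ]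
  split_ifs <;> simp

theorem posTrace_eigenProj (he : IsEigenbasis ω e p) (hω : 0 ≤ ω) (hf : IsEigenbasis φ f q)
    (hφ : 0 ≤ φ) (r s : ℝ) :
    posTrace (eigenProj ω r * eigenProj φ s * eigenProj ω r) =
      ∑' i, ∑' j, if p i = r ∧ q j = s then ‖⟪f j, e i⟫_ℂ‖ₑ ^ 2 else 0 := by
  rw [posTrace_eq e (IsSelfAdjoint.conjugate_nonneg (eigenProj_nonneg φ s)
    (eigenProj_isSelfAdjoint ω r))]
  refine tsum_congr fun i => ?_
  have h1 : quadForm (eigenProj ω r * eigenProj φ s * eigenProj ω r) (e i) =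
      quadForm (eigenProj φ s) (eigenProj ω r (e i)) := by
    rw [quadForm, quadForm, mul_apply_eq_comp, mul_apply_eq_comp,
      ← ContinuousLinearMap.adjoint_inner_left, ← ContinuousLinearMap.star_eq_adjoint,
      (eigenProj_isSelfAdjoint ω r).star_eq]
  rw [h1, he.eigenProj_apply hω, quadForm_eigenProj hf hφ]
  refine tsum_congr fun j => ?_
  by_cases hi : p i = r <;> simp [hi]

/-- Each pair `(i, j)` contributes to exactly one pair of eigenvalues, namely `(p i, q j)`;
interchanging the sums collapses those over all real `r` and `s`. -/
theorem tsum_posTrace_eigenProj (he : IsEigenbasis ω e p) (hω : 0 ≤ ω) (hf : IsEigenbasis φ f q)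
    (hφ : 0 ≤ φ) (F : ℝ → ℝ → ℝ≥0∞) :
    ∑' r, ∑' s, posTrace (eigenProj ω r * eigenProj φ s * eigenProj ω r) * F r s =
      ∑' i, ∑' j, ‖⟪f j, e i⟫_ℂ‖ₑ ^ 2 * F (p i) (q j) := by
  have h1 : ∀ r s, posTrace (eigenProj ω r * eigenProj φ s * eigenProj ω r) * F r s =
      ∑' i, ∑' j, if s = q j then (if r = p i then ‖⟪f j, e i⟫_ℂ‖ₑ ^ 2 * F r s else 0) else 0 := by
    intro r s
    rw [posTrace_eigenProj he hω hf hφ, ← ENNReal.tsum_mul_right]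
    refine tsum_congr fun i => ?_
    rw [← ENNReal.tsum_mul_right]
    refine tsum_congr fun j => ?_
    simp only [eq_comm (a := s), eq_comm (a := r)]
    by_cases hi : p i = r <;> by_cases hj : q j = s <;> simp [hi, hj]
  have h2 : ∀ r, ∑' s, posTrace (eigenProj ω r * eigenProj φ s * eigenProj ω r) * F r s =
      ∑' i, if r = p i then ∑' j, ‖⟪f j, e i⟫_ℂ‖ₑ ^ 2 * F r (q j) else 0 := by
    intro r
    simp_rw [h1]
    rw [ENNReal.tsum_comm]
    refine tsum_congr fun i => ?_
    rw [ENNReal.tsum_comm]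
    simp_rw [tsum_ite_eq]
    split_ifs <;> simp
  simp_rw [h2]
  rw [ENNReal.tsum_comm]
  simp_rw [tsum_ite_eq]

/-- This is `ln u ≤ u - 1` at `u = y / x`, multiplied by `x`. -/
theorem klein_nonneg {x y : ℝ} (hx : 0 ≤ x) (hy : 0 < y) :
    0 ≤ x * Real.log x - x * Real.log y + y - x := by
  rcases hx.eq_or_lt with rfl | hx
  · simpa using hy.le
  · have h := Real.log_le_sub_one_of_pos (div_pos hy hx)
    rw [Real.log_div hy.ne' hx.ne'] at h
    have h2 := mul_le_mul_of_nonneg_left h hx.le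
    have h3 : x * (y / x - 1) = y - x := by field_simp
    nlinarith

/-- Terms are arranged so that nothing is subtracted in `ℝ≥0∞`. The case `y = 0 < x` must be
excluded: there `Real.log 0 = 0` while `negLog 0 = ⊤`. -/
theorem entropy_terms_eq {x y : ℝ} (hx : 0 ≤ x) (hx1 : x ≤ 1) (hy : 0 ≤ y) (hy1 : y ≤ 1)
    (h : y = 0 → x = 0) :
    ENNReal.ofReal (x * Real.log x - x * Real.log y + y - x) +
        ENNReal.ofReal (Real.negMulLog x) + ENNReal.ofReal x =
      ENNReal.ofReal x * negLog y + ENNReal.ofReal y := by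
  rcases hy.eq_or_lt with rfl | hy
  · simp [h rfl]
  · have h1 := Real.negMulLog_nonneg hx hx1
    have h2 : 0 ≤ -Real.log y := by linarith [Real.log_nonpos hy.le hy1]
    rw [negLog, if_neg hy.not_ge, ← ENNReal.ofReal_add (klein_nonneg hx hy) h1,
      ← ENNReal.ofReal_add (add_nonneg (klein_nonneg hx hy) h1) hx, ← ENNReal.ofReal_mul hx,
      ← ENNReal.ofReal_add (mul_nonneg hx h2) hy.le, Real.negMulLog]
    congr 1
    ring

end

/-- If the sum were finite, `ω` would kill every eigenvector `f j` of eigenvalue zero; a vector of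
`ker φ` has no component along the others, so `ω` would kill it too. -/
theorem crossEntropy_eq_top {ω φ : H →L[ℂ] H} (hω : IsDensity ω) (hφ : IsDensity φ)
    (hker : ¬ φ.ker ≤ ω.ker) : crossEntropy ω φ = ⊤ := by
  obtain ⟨κ, f, q, hf⟩ := hφ.exists_isEigenbasis
  rw [crossEntropy_eq_tsum hf hφ hω.1]
  by_contra hne
  refine hker fun v hv => ?_
  have hv : φ v = 0 := hv
  have h0 : ∀ j, f.repr v j • ω (f j) = 0 := by
    intro j
    rw [f.repr_apply_apply]
    by_cases hj : q j ≤ 0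
    · have := ENNReal.ne_top_of_tsum_ne_top hne j
      rw [negLog, if_pos hj, Ne, ENNReal.mul_eq_top] at this
      have hz : quadForm ω (f j) = 0 := by
        by_contra h
        exact this (Or.inl ⟨h, rfl⟩)
      rw [eq_zero_of_quadForm_eq_zero hω.1 hz, smul_zero]
    · have := hf.inner_apply hφ.1 j v
      rw [hv, inner_zero_right, eq_comm, mul_eq_zero] at this
      rw [this.resolve_left (by exact_mod_cast (not_le.1 hj).ne'), zero_smul]
  have hs := (f.hasSum_repr v).mapL ω
  simp_rw [map_smul, h0] at hs
  exact hs.unique hasSum_zero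

/-- The relative entropy is the difference of the cross entropy and the entropy. -/
theorem entropy_add_relEntropy {ω φ : TraceClass H} (hω : ω ∈ states H) (hφ : φ ∈ states H) :
    entropy ω + relEntropy ω φ = crossEntropy (ω : H →L[ℂ] H) (φ : H →L[ℂ] H) := by
  have hω : IsDensity (ω : H →L[ℂ] H) := hω
  have hφ : IsDensity (φ : H →L[ℂ] H) := hφ
  rw [relEntropy]
  split_ifs with hker
  swap
  · rw [crossEntropy_eq_top hω hφ hker, add_top]
  obtain ⟨ι, e, p, he⟩ := hω.exists_isEigenbasis
  obtain ⟨κ, f, q, hf⟩ := hφ.exists_isEigenbasis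
  -- The weights `|⟨f j, e i⟩|²` are doubly stochastic, so every single sum becomes a double sum
  -- with the same weights and the identity can be checked termwise.
  have hp : ∀ g : ℝ → ℝ≥0∞, ∑' i, g (p i) = ∑' i, ∑' j, ‖⟪f j, e i⟫_ℂ‖ₑ ^ 2 * g (p i) := by
    intro g
    refine tsum_congr fun i => ?_
    rw [ENNReal.tsum_mul_right, tsum_enorm_inner_sq, ← ofReal_norm, e.orthonormal.1 i]
    simp
  have hq : ∑' j, ENNReal.ofReal (q j) =
      ∑' i, ∑' j, ‖⟪f j, e i⟫_ℂ‖ₑ ^ 2 * ENNReal.ofReal (q j) := by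
    rw [ENNReal.tsum_comm]
    refine tsum_congr fun j => ?_
    simp_rw [enorm_inner_symm (f j)]
    rw [ENNReal.tsum_mul_right, tsum_enorm_inner_sq, ← ofReal_norm, f.orthonormal.1 j]
    simp
  have hcross : crossEntropy (ω : H →L[ℂ] H) (φ : H →L[ℂ] H) =
      ∑' i, ∑' j, ‖⟪f j, e i⟫_ℂ‖ₑ ^ 2 * (ENNReal.ofReal (p i) * negLog (q j)) := by
    rw [crossEntropy_eq_tsum hf hφ hω.1, ENNReal.tsum_comm]
    refine tsum_congr fun j => ?_
    rw [he.quadForm_eq_tsum hω.1, ← ENNReal.tsum_mul_right]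
    refine tsum_congr fun i => ?_
    rw [enorm_inner_symm (f j)]
    ring
  -- The added `1` is read as `∑ p` on the left and `∑ q` on the right, to balance the terms `q - p`
  -- in `relEntropy`.
  refine (ENNReal.add_left_inj ENNReal.one_ne_top).1 ?_
  have hone : (1 : ℝ≥0∞) = ∑' i, ENNReal.ofReal (p i) := by
    rw [he.tsum_eq_posTrace hω.1, hω.2]
  have hone' : (1 : ℝ≥0∞) = ∑' j, ENNReal.ofReal (q j) := by
    rw [hf.tsum_eq_posTrace hφ.1, hφ.2]
  rw [entropy, he.posTrace_negMulLog hω, add_comm (∑' i, ENNReal.ofReal (Real.negMulLog (p i))),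
    tsum_posTrace_eigenProj he hω.1 hf hφ.1
      (fun p q => ENNReal.ofReal (p * Real.log p - p * Real.log q + q - p)), hcross]
  conv_lhs => rw [hone]
  conv_rhs => rw [hone']
  rw [hp fun x => ENNReal.ofReal (Real.negMulLog x), hp fun x => ENNReal.ofReal x, hq]
  simp_rw [← ENNReal.tsum_add]
  refine tsum_congr fun i => tsum_congr fun j => ?_
  rw [← mul_add, ← mul_add, ← mul_add]
  by_cases h : q j = 0 → p i = 0
  · rw [entropy_terms_eq (he.nonneg hω.1 i) (he.le_one hω.1 hω.2 i) (hf.nonneg hφ.1 j)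
      (hf.le_one hφ.1 hφ.2 j) h]
  -- Here `f j` lies in `ker φ ≤ ker ω` while `p i ≠ 0`, so `f j` is orthogonal to `e i` and the
  -- weight vanishes.
  · push Not at h
    have hmem : f j ∈ (φ : H →L[ℂ] H).ker := by
      change (φ : H →L[ℂ] H) (f j) = 0
      rw [hf j, h.1]
      simp
    have hz : (ω : H →L[ℂ] H) (f j) = 0 := hker hmem
    have h3 := he.inner_apply hω.1 i (f j)
    rw [hz, inner_zero_right, eq_comm, mul_eq_zero] at h3
    have h4 := h3.resolve_left (by exact_mod_cast h.2)
    rw [enorm_inner_symm, h4]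
    simp

/-- The Klein inequality. -/
theorem entropy_le_crossEntropy {ω φ : TraceClass H} (hω : ω ∈ states H) (hφ : φ ∈ states H) :
    entropy ω ≤ crossEntropy (ω : H →L[ℂ] H) (φ : H →L[ℂ] H) := by
  rw [← entropy_add_relEntropy hω hφ]
  exact le_self_add

/-! ### Lower semicontinuity -/

/-- For a fixed cut-off each diagonal term is norm continuous in `φ`, all spectra lying in `[0, 1]`;
sums and suprema keep lower semicontinuity. -/
theorem lowerSemicontinuousWithinAt_crossEntropy {X : Type*} [TopologicalSpace X]
    (ω : H →L[ℂ] H) {φ : X → H →L[ℂ] H} {s : Set X} {x₀ : X} (hx₀ : x₀ ∈ s)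
    (hc : ContinuousWithinAt φ s x₀) (hφ : ∀ x ∈ s, IsDensity (φ x)) :
    LowerSemicontinuousWithinAt (fun x => crossEntropy ω (φ x)) s x₀ := by
  refine lowerSemicontinuousWithinAt_iSup fun n => lowerSemicontinuousWithinAt_tsum fun e => ?_
  refine ContinuousWithinAt.lowerSemicontinuousWithinAt ?_
  have hG : ContinuousWithinAt (fun x => cfc (sqrtNegLog n) (φ x)) s x₀ :=
    hc.cfc (isCompact_Icc (a := (0 : ℝ)) (b := 1)) _ hx₀
      (eventually_mem_nhdsWithin.mono fun x hx => (hφ x hx).spectrum_subset)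
      (eventually_mem_nhdsWithin.mono fun x hx => IsSelfAdjoint.of_nonneg (hφ x hx).1)
      (continuous_sqrtNegLog n).continuousOn
  have hM := (hG.mul (continuousWithinAt_const (b := ω))).mul hG
  have hMe := hM.clm_apply (continuousWithinAt_const (b := (e : H)))
  exact ENNReal.continuous_ofReal.continuousAt.comp_continuousWithinAt
    (RCLike.continuous_re.continuousAt.comp_continuousWithinAt
      ((continuousWithinAt_const (b := (e : H))).inner (𝕜 := ℂ) hMe))

/-! ### Mixtures of states -/

theorem coe_mix (φ ρ : TraceClass H) (c : ℝ) :
    (mix φ ρ c : H →L[ℂ] H) = (1 - c) • (φ : H →L[ℂ] H) + c • (ρ : H →L[ℂ] H) := by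
  simp [mix]

@[simp]
theorem mix_zero (φ ρ : TraceClass H) : mix φ ρ 0 = φ := by simp [mix]

@[simp]
theorem mix_one (φ ρ : TraceClass H) : mix φ ρ 1 = ρ := by simp [mix]

theorem mix_mem_states {φ ρ : TraceClass H} (hφ : φ ∈ states H) (hρ : ρ ∈ states H) {c : ℝ}
    (hc : c ∈ Icc (0 : ℝ) 1) : mix φ ρ c ∈ states H := by
  have hc' : 0 ≤ 1 - c := sub_nonneg.2 hc.2
  have h1 : 0 ≤ (1 - c) • (φ : H →L[ℂ] H) := smul_nonneg hc' hφ.1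
  have h2 : 0 ≤ c • (ρ : H →L[ℂ] H) := smul_nonneg hc.1 hρ.1
  change 0 ≤ (mix φ ρ c : H →L[ℂ] H) ∧ posTrace (mix φ ρ c : H →L[ℂ] H) = 1
  rw [coe_mix]
  refine ⟨add_nonneg h1 h2, ?_⟩
  rw [posTrace_eq_quadForm]
  simp_rw [quadForm_add h1 h2, quadForm_smul _ hc', quadForm_smul _ hc.1]
  rw [ENNReal.tsum_add, ENNReal.tsum_mul_left, ENNReal.tsum_mul_left, ← posTrace_eq_quadForm,
    ← posTrace_eq_quadForm, hφ.2, hρ.2, mul_one, mul_one, ← ENNReal.ofReal_add hc' hc.1]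
  simp

theorem crossEntropy_mix {φ ρ σ : TraceClass H} (hφ : φ ∈ states H) (hρ : ρ ∈ states H)
    (hσ : σ ∈ states H) {c : ℝ} (hc : c ∈ Icc (0 : ℝ) 1) :
    crossEntropy (mix φ ρ c : H →L[ℂ] H) (σ : H →L[ℂ] H) =
      ENNReal.ofReal (1 - c) * crossEntropy (φ : H →L[ℂ] H) (σ : H →L[ℂ] H) +
        ENNReal.ofReal c * crossEntropy (ρ : H →L[ℂ] H) (σ : H →L[ℂ] H) := by
  rw [coe_mix]
  exact crossEntropy_combo hσ hφ.1 hρ.1 (sub_nonneg.2 hc.2) hc.1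

theorem entropy_eq_crossEntropy {φ : TraceClass H} (hφ : φ ∈ states H) :
    entropy φ = crossEntropy (φ : H →L[ℂ] H) (φ : H →L[ℂ] H) :=
  (crossEntropy_self hφ).symm

theorem entropy_mix_le {φ ρ : TraceClass H} (hφ : φ ∈ states H) (hρ : ρ ∈ states H) {c : ℝ}
    (hc : c ∈ Icc (0 : ℝ) 1) :
    entropy (mix φ ρ c) ≤ ENNReal.ofReal (1 - c) * entropy φ +
      ENNReal.ofReal c * crossEntropy (ρ : H →L[ℂ] H) (φ : H →L[ℂ] H) := by
  rw [entropy_eq_crossEntropy hφ, ← crossEntropy_mix hφ hρ hφ hc]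
  exact entropy_le_crossEntropy (mix_mem_states hφ hρ hc) hφ

/-- Here the reference state is the mixture itself; affinity splits its cross entropy, and Klein's
inequality bounds the `φ` part only. -/
theorem le_entropy_mix {φ ρ : TraceClass H} (hφ : φ ∈ states H) (hρ : ρ ∈ states H) {c : ℝ}
    (hc : c ∈ Icc (0 : ℝ) 1) :
    ENNReal.ofReal (1 - c) * entropy φ +
      ENNReal.ofReal c * crossEntropy (ρ : H →L[ℂ] H) (mix φ ρ c : H →L[ℂ] H) ≤
        entropy (mix φ ρ c) := by
  have hm := mix_mem_states hφ hρ hc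
  rw [entropy_eq_crossEntropy hm, crossEntropy_mix hφ hρ hm hc]
  gcongr
  exact entropy_le_crossEntropy hφ hm

theorem lowerSemicontinuousWithinAt_crossEntropy_mix {φ ρ : TraceClass H} (hφ : φ ∈ states H)
    (hρ : ρ ∈ states H) :
    LowerSemicontinuousWithinAt
      (fun c => crossEntropy (ρ : H →L[ℂ] H) (mix φ ρ c : H →L[ℂ] H)) (Icc 0 1) 0 := by
  refine lowerSemicontinuousWithinAt_crossEntropy _ ⟨le_rfl, zero_le_one⟩ ?_
    fun c hc => mix_mem_states hφ hρ hc
  simp_rw [coe_mix]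
  exact Continuous.continuousWithinAt (by fun_prop)

/-! ### Right derivative of the entropy along a mixture. -/

/-- The difference quotient of the entropy along a mixture, shifted by `S(φ)`. -/
noncomputable def mixQuotient (φ ρ : TraceClass H) (c : ℝ) : ℝ :=
  ((entropy (mix φ ρ c)).toReal - (1 - c) * (entropy φ).toReal) / c

section

variable {φ ρ : TraceClass H}

theorem crossEntropy_mix_le_mixQuotient (hφ : φ ∈ states H) (hρ : ρ ∈ states H)
    (hfin : ∀ c ∈ Icc (0 : ℝ) 1, entropy (mix φ ρ c) ≠ ⊤)
    {c : ℝ} (hc : c ∈ Ioc (0 : ℝ) 1) :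
    crossEntropy (ρ : H →L[ℂ] H) (mix φ ρ c : H →L[ℂ] H) ≤ ENNReal.ofReal (mixQuotient φ ρ c) ∧
      0 ≤ mixQuotient φ ρ c := by
  have hc' : c ∈ Icc (0 : ℝ) 1 := ⟨hc.1.le, hc.2⟩
  have h0 : entropy φ ≠ ⊤ := by simpa using hfin 0 ⟨le_rfl, zero_le_one⟩
  have hle := le_entropy_mix hφ hρ hc'
  set C := crossEntropy (ρ : H →L[ℂ] H) (mix φ ρ c : H →L[ℂ] H) with hC
  have hcC : ENNReal.ofReal c * C ≠ ⊤ :=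
    ne_top_of_le_ne_top (hfin c hc') (le_add_self.trans hle)
  have hCtop : C ≠ ⊤ := by
    intro h
    rw [h, ENNReal.mul_top (by simpa using hc.1)] at hcC
    exact hcC rfl
  have hr := ENNReal.toReal_mono (hfin c hc') hle
  rw [ENNReal.toReal_add (ENNReal.mul_ne_top ENNReal.ofReal_ne_top h0) hcC, ENNReal.toReal_mul,
    ENNReal.toReal_mul, ENNReal.toReal_ofReal (sub_nonneg.2 hc.2),
    ENNReal.toReal_ofReal hc.1.le] at hr
  have hk : C.toReal ≤ mixQuotient φ ρ c := by
    rw [mixQuotient, le_div_iff₀ hc.1]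
    linarith
  exact ⟨(ENNReal.le_ofReal_iff_toReal_le hCtop (ENNReal.toReal_nonneg.trans hk)).2 hk,
    ENNReal.toReal_nonneg.trans hk⟩

theorem mixQuotient_le (hφ : φ ∈ states H) (hρ : ρ ∈ states H)
    (hfin : ∀ c ∈ Icc (0 : ℝ) 1, entropy (mix φ ρ c) ≠ ⊤)
    (hC : crossEntropy (ρ : H →L[ℂ] H) (φ : H →L[ℂ] H) ≠ ⊤) {c : ℝ}
    (hc : c ∈ Ioc (0 : ℝ) 1) :
    mixQuotient φ ρ c ≤ (crossEntropy (ρ : H →L[ℂ] H) (φ : H →L[ℂ] H)).toReal := by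
  have hc' : c ∈ Icc (0 : ℝ) 1 := ⟨hc.1.le, hc.2⟩
  have h0 : entropy φ ≠ ⊤ := by simpa using hfin 0 ⟨le_rfl, zero_le_one⟩
  have h1 : ENNReal.ofReal (1 - c) * entropy φ ≠ ⊤ := ENNReal.mul_ne_top ENNReal.ofReal_ne_top h0
  have h2 : ENNReal.ofReal c * crossEntropy (ρ : H →L[ℂ] H) (φ : H →L[ℂ] H) ≠ ⊤ :=
    ENNReal.mul_ne_top ENNReal.ofReal_ne_top hC
  have hr := ENNReal.toReal_mono (ENNReal.add_ne_top.2 ⟨h1, h2⟩) (entropy_mix_le hφ hρ hc')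
  rw [ENNReal.toReal_add h1 h2, ENNReal.toReal_mul, ENNReal.toReal_mul,
    ENNReal.toReal_ofReal (sub_nonneg.2 hc.2), ENNReal.toReal_ofReal hc.1.le] at hr
  rw [mixQuotient, div_le_iff₀ hc.1]
  linarith

theorem hasDerivWithinAt_entropy_mix_iff (m : ℝ) :
    HasDerivWithinAt (fun c => (entropy (mix φ ρ c)).toReal) m (Ici 0) 0 ↔
      Tendsto (mixQuotient φ ρ) (𝓝[>] 0) (𝓝 (m + (entropy φ).toReal)) := by
  rw [hasDerivWithinAt_iff_tendsto_slope, Ici_sdiff_left]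
  have h : ∀ᶠ c in 𝓝[>] (0 : ℝ), slope (fun c => (entropy (mix φ ρ c)).toReal) 0 c +
      (entropy φ).toReal = mixQuotient φ ρ c := by
    filter_upwards [self_mem_nhdsWithin] with c hc
    have hc : c ≠ 0 := ne_of_gt hc
    rw [slope_def_field, mixQuotient, mix_zero]
    field_simp
    ring
  rw [← tendsto_congr' h]
  refine ⟨fun h => h.add_const _, fun h => ?_⟩
  simpa using h.sub_const (entropy φ).toReal

theorem eventually_lt_crossEntropy_mix (hφ : φ ∈ states H) (hρ : ρ ∈ states H)
    (hfin : ∀ c ∈ Icc (0 : ℝ) 1, entropy (mix φ ρ c) ≠ ⊤)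
    {y : ℝ≥0∞}
    (hy : y < crossEntropy (ρ : H →L[ℂ] H) (φ : H →L[ℂ] H)) :
    ∀ᶠ c in 𝓝[>] (0 : ℝ), y < ENNReal.ofReal (mixQuotient φ ρ c) := by
  have h := lowerSemicontinuousWithinAt_crossEntropy_mix hφ hρ y (by simpa using hy)
  have hle : 𝓝[>] (0 : ℝ) ≤ 𝓝[Icc 0 1] 0 := by
    rw [← nhdsWithin_Ioc_eq_nhdsGT zero_lt_one]
    exact nhdsWithin_mono _ Ioc_subset_Icc_self
  filter_upwards [hle h, Ioc_mem_nhdsGT zero_lt_one] with c h1 h2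
  exact h1.trans_le (crossEntropy_mix_le_mixQuotient hφ hρ hfin h2).1

/-- An infinite cross entropy would, by lower semicontinuity, drive the difference quotients to
infinity. This supplies finiteness at times `t > 0`, where it is not assumed. -/
theorem crossEntropy_ne_top_of_hasDerivWithinAt (hφ : φ ∈ states H) (hρ : ρ ∈ states H)
    (hfin : ∀ c ∈ Icc (0 : ℝ) 1, entropy (mix φ ρ c) ≠ ⊤)
    {m : ℝ}
    (hm : HasDerivWithinAt (fun c => (entropy (mix φ ρ c)).toReal) m (Ici 0) 0) :
    crossEntropy (ρ : H →L[ℂ] H) (φ : H →L[ℂ] H) ≠ ⊤ := by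
  intro htop
  rw [hasDerivWithinAt_entropy_mix_iff] at hm
  have h1 := hm.eventually (gt_mem_nhds (lt_add_one (m + (entropy φ).toReal)))
  have h2 := eventually_lt_crossEntropy_mix hφ hρ hfin
    (y := ENNReal.ofReal (m + (entropy φ).toReal + 1)) (by rw [htop]; exact ENNReal.ofReal_lt_top)
  obtain ⟨c, h1, h2⟩ := (h1.and h2).exists
  exact absurd (ENNReal.ofReal_le_ofReal h1.le) h2.not_ge

/-- The quotient is squeezed between the cross entropies of `ρ` relative to the mixture and relative
to `φ`; lower semicontinuity closes the gap. -/
theorem hasDerivWithinAt_entropy_mix (hφ : φ ∈ states H) (hρ : ρ ∈ states H)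
    (hfin : ∀ c ∈ Icc (0 : ℝ) 1, entropy (mix φ ρ c) ≠ ⊤)
    (hC : crossEntropy (ρ : H →L[ℂ] H) (φ : H →L[ℂ] H) ≠ ⊤) :
    HasDerivWithinAt (fun c => (entropy (mix φ ρ c)).toReal)
      ((crossEntropy (ρ : H →L[ℂ] H) (φ : H →L[ℂ] H)).toReal - (entropy φ).toReal) (Ici 0) 0 := by
  rw [hasDerivWithinAt_entropy_mix_iff, sub_add_cancel, tendsto_order]
  constructor
  · intro y hy
    rcases lt_or_ge y 0 with h0 | h0
    · filter_upwards [Ioc_mem_nhdsGT zero_lt_one] with c hc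
      exact h0.trans_le (crossEntropy_mix_le_mixQuotient hφ hρ hfin hc).2
    · have := eventually_lt_crossEntropy_mix hφ hρ hfin
        ((ENNReal.ofReal_lt_iff_lt_toReal h0 hC).2 hy)
      filter_upwards [this] with c hc
      exact (ENNReal.ofReal_lt_ofReal_iff_of_nonneg h0).1 hc
  · intro y hy
    filter_upwards [Ioc_mem_nhdsGT zero_lt_one] with c hc
    exact (mixQuotient_le hφ hρ hfin hC hc).trans_lt hy

end

/-! ### Entropy production along trajectories -/

theorem map_mem_states (T : QuantumDynamicalSemigroup H) {t : ℝ} (ht : 0 ≤ t) {φ : TraceClass H}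
    (hφ : φ ∈ states H) : T.map t φ ∈ states H := by
  refine ⟨?_, (T.trace_map t ht φ hφ.1).trans hφ.2⟩
  -- Only `1 × 1` blocks are needed: plain positivity.
  have h := T.completelyPositive t ht 1 (fun _ _ => φ) fun v => by
    simpa using (isPositive_of_nonneg hφ.1).inner_nonneg_right (v 0)
  rw [ContinuousLinearMap.nonneg_iff_isPositive, ContinuousLinearMap.isPositive_iff_complex]
  intro x
  have hx := h fun _ => x
  simp only [Finset.univ_unique, Finset.sum_singleton] at hx
  rw [Complex.nonneg_iff] at hx
  have hconj : (starRingEnd ℂ) ⟪x, (T.map t φ : H →L[ℂ] H) x⟫_ℂ =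
      ⟪x, (T.map t φ : H →L[ℂ] H) x⟫_ℂ := Complex.conj_eq_iff_im.2 hx.2.symm
  rw [← inner_conj_symm, hconj]
  exact ⟨Complex.conj_eq_iff_re.1 hconj, hx.1⟩

theorem map_mix (T : QuantumDynamicalSemigroup H) (t : ℝ) (φ ρ : TraceClass H) (c : ℝ) :
    T.map t (mix φ ρ c) = mix (T.map t φ) (T.map t ρ) c := by
  simp [mix, LinearMap.map_smul_of_tower]

theorem IsLinearOnStates.toReal_mix {Q : TraceClass H → EReal} (hQ : IsLinearOnStates Q)
    {φ ρ : TraceClass H} (hφ : φ ∈ states H) (hρ : ρ ∈ states H) (hφQ : Q φ ≠ ⊤) (hρQ : Q ρ ≠ ⊤)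
    {c : ℝ} (hc : c ∈ Icc (0 : ℝ) 1) :
    (Q (mix φ ρ c)).toReal = (1 - c) * (Q φ).toReal + c * (Q ρ).toReal := by
  rw [mix, hQ.map_mix φ hφ ρ hρ c hc.1 hc.2]
  conv_lhs => rw [← EReal.coe_toReal hφQ (hQ.ne_bot φ hφ), ← EReal.coe_toReal hρQ (hQ.ne_bot ρ hρ)]
  norm_cast

theorem entropyQuotient_eq (T : QuantumDynamicalSemigroup H) {ω : TraceClass H} {t : ℝ}
    (h0 : entropy ω ≠ ⊤) (ht : entropy (T.map t ω) ≠ ⊤) :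
    entropyQuotient T ω t =
      ((((entropy (T.map t ω)).toReal - (entropy ω).toReal) / t : ℝ) : EReal) := by
  rw [entropyQuotient, EReal.coe_div, EReal.coe_sub, EReal.coe_ennreal_toReal h0,
    EReal.coe_ennreal_toReal ht]

theorem epRate_eq {T : QuantumDynamicalSemigroup H} {Q : TraceClass H → EReal} {ω : TraceClass H}
    {r : ℝ} (h0 : entropy ω ≠ ⊤) (hr : Tendsto (entropyQuotient T ω) (𝓝[>] 0) (𝓝 (r : EReal)))
    (hQ : Q ω ≠ ⊤) (hQ' : Q ω ≠ ⊥) : epRate T Q ω = ((r + (Q ω).toReal : ℝ) : EReal) := by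
  rw [epRate, entropyRate, if_neg h0, hr.limsup_eq, EReal.coe_add, EReal.coe_toReal hQ hQ']

theorem tendsto_entropyQuotient {T : QuantumDynamicalSemigroup H} {ω : TraceClass H} {r : ℝ}
    (hfin : ∀ᶠ t in 𝓝[≥] (0 : ℝ), entropy (T.map t ω) ≠ ⊤) :
    Tendsto (entropyQuotient T ω) (𝓝[>] 0) (𝓝 (r : EReal)) ↔
      HasDerivWithinAt (fun t => (entropy (T.map t ω)).toReal) r (Ici 0) 0 := by
  have h0 : entropy ω ≠ ⊤ := by
    simpa [T.map_zero] using hfin.self_of_nhdsWithin (mem_Ici.2 le_rfl)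
  rw [hasDerivWithinAt_iff_tendsto_slope, Ici_sdiff_left, ← EReal.tendsto_coe]
  refine tendsto_congr' ?_
  filter_upwards [nhdsWithin_mono _ Ioi_subset_Ici_self hfin] with t ht
  rw [entropyQuotient_eq T h0 ht, slope_def_field, T.map_zero]
  simp

/-- An absolutely continuous entropy is differentiable at almost every `s`, where the semigroup law
identifies its derivative with the entropy rate of `T.map s ω`; it is then recovered by integration.
-/
theorem integratedEP_eq {T : QuantumDynamicalSemigroup H} {Q : TraceClass H → EReal}
    (hQ : IsLinearOnStates Q) {ω : TraceClass H} (hω : ω ∈ states H) {τ : ℝ}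
    (hreg : TimeRegular T Q τ ω) {t : ℝ} (ht : t ∈ Icc 0 τ) :
    integratedEP T Q ω t = (entropy (T.map t ω)).toReal - (entropy ω).toReal +
      ∫ s in (0 : ℝ)..t, (Q (T.map s ω)).toReal := by
  have hac := hreg.entropy_ac.mono (c := 0) (d := t) (by
    rw [uIcc_of_le ht.1, uIcc_of_le (ht.1.trans ht.2)]
    exact Icc_subset_Icc_right ht.2)
  have hftc := hac.integral_deriv_eq_sub
  simp only [T.map_zero, LinearMap.id_apply] at hftc
  have hint : IntervalIntegrable (fun s => (Q (T.map s ω)).toReal) MeasureTheory.volume 0 t := by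
    refine ContinuousOn.intervalIntegrable (hreg.flow_continuous.mono ?_)
    rw [uIcc_of_le ht.1]
    exact Icc_subset_Icc_right ht.2
  rw [← hftc, ← intervalIntegral.integral_add hac.intervalIntegrable_deriv hint, integratedEP]
  refine intervalIntegral.integral_congr_ae ?_
  -- Excluding the endpoint leaves room to the right of `s` inside `[0, τ]`.
  have hne : ∀ᵐ s : ℝ, s ≠ t := by simp [MeasureTheory.ae_iff]
  filter_upwards [hac.ae_differentiableAt, hne] with s hs hst hmem
  rw [uIoc_of_le ht.1] at hmem
  have hs' := (hs (by rw [uIcc_of_le ht.1]; exact Ioc_subset_Icc_self hmem)).hasDerivAt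
  have hlt : s < t := lt_of_le_of_ne hmem.2 hst
  have hsτ : s ∈ Icc 0 τ := ⟨hmem.1.le, hmem.2.trans ht.2⟩
  have hfin : ∀ᶠ h in 𝓝[≥] (0 : ℝ), entropy (T.map h (T.map s ω)) ≠ ⊤ := by
    filter_upwards [Icc_mem_nhdsGE (sub_pos.2 hlt)] with h hh
    have := hreg.entropy_ne_top (h + s) ⟨add_nonneg hh.1 hsτ.1, by linarith [hh.2, ht.2]⟩
    rwa [T.map_add h s hh.1 hsτ.1] at this
  have hderiv : HasDerivWithinAt (fun h => (entropy (T.map h (T.map s ω))).toReal)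
      (deriv (fun t => (entropy (T.map t ω)).toReal) s) (Ici 0) 0 := by
    have h1 : HasDerivWithinAt (fun h => (entropy (T.map (h + s) ω)).toReal)
        (deriv (fun t => (entropy (T.map t ω)).toReal) s) (Ici 0) 0 := by
      have : HasDerivAt (fun t => (entropy (T.map t ω)).toReal)
        (deriv (fun t => (entropy (T.map t ω)).toReal) s) (0 + s) := by rwa [zero_add]
      exact (this.comp_add_const 0 s).hasDerivWithinAt
    refine h1.congr (fun h hh => ?_) ?_
    · rw [T.map_add h s hh hsτ.1]
      rfl
    · rw [T.map_add 0 s le_rfl hsτ.1]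
      rfl
  rw [epRate_eq (hreg.entropy_ne_top s hsτ) ((tendsto_entropyQuotient hfin).2 hderiv)
    (hreg.flow_ne_top s hsτ) (hQ.ne_bot _ (map_mem_states T hsτ.1 hω)), EReal.toReal_coe]

theorem TimeRegular.hasDerivWithinAt_integral_flow {T : QuantumDynamicalSemigroup H}
    {Q : TraceClass H → EReal} {ω : TraceClass H} {τ : ℝ} (hτ : 0 < τ)
    (hreg : TimeRegular T Q τ ω) :
    HasDerivWithinAt (fun t => ∫ s in (0 : ℝ)..t, (Q (T.map s ω)).toReal) (Q ω).toReal
      (Ici 0) 0 := by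
  have h := intervalIntegral.integral_hasDerivWithinAt_right (a := (0 : ℝ)) (b := 0)
    (f := fun s => (Q (T.map s ω)).toReal) (s := Ici 0) (t := Ioi 0)
    IntervalIntegrable.refl
    ⟨Ioc 0 τ, Ioc_mem_nhdsGT hτ,
      (hreg.flow_continuous.mono Ioc_subset_Icc_self).aestronglyMeasurable measurableSet_Ioc⟩
    (by
      have := hreg.flow_continuous 0 ⟨le_rfl, hτ.le⟩
      rw [ContinuousWithinAt, ← nhdsWithin_Ioc_eq_nhdsGT hτ]
      exact this.mono_left (nhdsWithin_mono _ Ioc_subset_Icc_self))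
  simpa only [T.map_zero, LinearMap.id_apply] using h

/-! ### The derivative of the relative entropy -/

/-- The relative entropy of the evolved states, in terms of the derivative of the integrated entropy
production along the mixture. -/
theorem relEntropy_map_eq {T : QuantumDynamicalSemigroup H} {Q : TraceClass H → EReal}
    (hQ : IsLinearOnStates Q) {φ ρ : TraceClass H} (hφ : φ ∈ states H) (hρ : ρ ∈ states H)
    (hrel : relEntropy ρ φ ≠ ⊤) {τ : ℝ}
    (hreg : ∀ c ∈ Icc (0 : ℝ) 1, TimeRegular T Q τ (mix φ ρ c)) {t : ℝ} (ht : t ∈ Icc 0 τ) {d : ℝ}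
    (hd : HasDerivWithinAt (fun c => integratedEP T Q (mix φ ρ c) t) d (Ici 0) 0) :
    relEntropy (T.map t ρ) (T.map t φ) ≠ ⊤ ∧
      (relEntropy (T.map t ρ) (T.map t φ)).toReal =
        d - (((entropy (T.map t ρ)).toReal - (entropy ρ).toReal) -
          ((entropy (T.map t φ)).toReal - (entropy φ).toReal)) -
          ((∫ s in (0 : ℝ)..t, (Q (T.map s ρ)).toReal) -
            ∫ s in (0 : ℝ)..t, (Q (T.map s φ)).toReal) + (relEntropy ρ φ).toReal := by
  have hτ : 0 ≤ τ := ht.1.trans ht.2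
  have h0 : (0 : ℝ) ∈ Icc (0 : ℝ) 1 := ⟨le_rfl, zero_le_one⟩
  have h1 : (1 : ℝ) ∈ Icc (0 : ℝ) 1 := ⟨zero_le_one, le_rfl⟩
  have hregφ : TimeRegular T Q τ φ := by simpa using hreg 0 h0
  have hregρ : TimeRegular T Q τ ρ := by simpa using hreg 1 h1
  have hφt := map_mem_states T ht.1 hφ
  have hρt := map_mem_states T ht.1 hρ
  have hfin : ∀ c ∈ Icc (0 : ℝ) 1, entropy (mix φ ρ c) ≠ ⊤ := fun c hc => by
    simpa [T.map_zero] using (hreg c hc).entropy_ne_top 0 ⟨le_rfl, hτ⟩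
  have hfint : ∀ c ∈ Icc (0 : ℝ) 1, entropy (mix (T.map t φ) (T.map t ρ) c) ≠ ⊤ := fun c hc => by
    simpa [map_mix] using (hreg c hc).entropy_ne_top t ht
  have hSρ : entropy ρ ≠ ⊤ := by simpa using hfin 1 h1
  have hSρt : entropy (T.map t ρ) ≠ ⊤ := by simpa using hfint 1 h1
  have hC := entropy_add_relEntropy hρ hφ
  have hCt := entropy_add_relEntropy hρt hφt
  have hCtop : crossEntropy (ρ : H →L[ℂ] H) (φ : H →L[ℂ] H) ≠ ⊤ := by
    rw [← hC]
    exact ENNReal.add_ne_top.2 ⟨hSρ, hrel⟩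
  have hmix := hasDerivWithinAt_entropy_mix hφ hρ hfin hCtop
  set Iφ := ∫ s in (0 : ℝ)..t, (Q (T.map s φ)).toReal with hIφ
  set Iρ := ∫ s in (0 : ℝ)..t, (Q (T.map s ρ)).toReal with hIρ
  have hsub : uIcc 0 t ⊆ Icc 0 τ := by
    rw [uIcc_of_le ht.1]
    exact Icc_subset_Icc_right ht.2
  have hintφ : IntervalIntegrable (fun s => (Q (T.map s φ)).toReal) MeasureTheory.volume 0 t :=
    ContinuousOn.intervalIntegrable (hregφ.flow_continuous.mono hsub)
  have hintρ : IntervalIntegrable (fun s => (Q (T.map s ρ)).toReal) MeasureTheory.volume 0 t :=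
    ContinuousOn.intervalIntegrable (hregρ.flow_continuous.mono hsub)
  have hQint : ∀ c ∈ Icc (0 : ℝ) 1,
      ∫ s in (0 : ℝ)..t, (Q (T.map s (mix φ ρ c))).toReal = (1 - c) * Iφ + c * Iρ := by
    intro c hc
    rw [hIφ, hIρ, ← intervalIntegral.integral_const_mul, ← intervalIntegral.integral_const_mul,
      ← intervalIntegral.integral_add (hintφ.const_mul _) (hintρ.const_mul _)]
    refine intervalIntegral.integral_congr fun s hs => ?_
    have hs := hsub hs
    simp only [map_mix]
    exact hQ.toReal_mix (map_mem_states T hs.1 hφ) (map_mem_states T hs.1 hρ)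
      (hregφ.flow_ne_top s hs) (hregρ.flow_ne_top s hs) hc
  -- By linearity of the evolution, the evolved mixture is a mixture of evolved states, so the
  -- mixture derivative formula also applies at time `t`.
  have heq : ∀ c ∈ Icc (0 : ℝ) 1, (entropy (mix (T.map t φ) (T.map t ρ) c)).toReal =
      integratedEP T Q (mix φ ρ c) t + (entropy (mix φ ρ c)).toReal - ((1 - c) * Iφ + c * Iρ) := by
    intro c hc
    rw [integratedEP_eq hQ (mix_mem_states hφ hρ hc) (hreg c hc) ht, hQint c hc, map_mix]
    ring
  have hlin : HasDerivWithinAt (fun c : ℝ => (1 - c) * Iφ + c * Iρ) (Iρ - Iφ) (Ici 0) 0 := by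
    have := (((hasDerivAt_id (0 : ℝ)).const_sub 1).mul_const Iφ).add
      ((hasDerivAt_id (0 : ℝ)).mul_const Iρ)
    exact (this.congr_deriv (by ring)).hasDerivWithinAt
  have hmixt : HasDerivWithinAt (fun c => (entropy (mix (T.map t φ) (T.map t ρ) c)).toReal)
      (d + ((crossEntropy (ρ : H →L[ℂ] H) (φ : H →L[ℂ] H)).toReal - (entropy φ).toReal) -
        (Iρ - Iφ)) (Ici 0) 0 := by
    refine ((hd.add hmix).sub hlin).congr_of_eventuallyEq ?_ (heq 0 h0)
    filter_upwards [Icc_mem_nhdsGE zero_lt_one] with c hc using heq c hc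
  have hCttop := crossEntropy_ne_top_of_hasDerivWithinAt hφt hρt hfint hmixt
  -- The same right derivative, computed from the entropy balance and from the cross entropy at time
  -- `t`.
  have huniq := (uniqueDiffWithinAt_Ici (0 : ℝ)).eq_deriv _ hmixt
    (hasDerivWithinAt_entropy_mix hφt hρt hfint hCttop)
  have hrelt : relEntropy (T.map t ρ) (T.map t φ) ≠ ⊤ :=
    ne_top_of_le_ne_top hCttop (hCt ▸ le_add_self)
  refine ⟨hrelt, ?_⟩
  rw [← hC, ← hCt, ENNReal.toReal_add hSρ hrel, ENNReal.toReal_add hSρt hrelt] at huniq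
  linarith

/-! ### First-order conditions at the minimizer. -/

theorem nonneg_of_isMinOn_of_hasDerivWithinAt {f : ℝ → ℝ} {d : ℝ}
    (hd : HasDerivWithinAt f d (Ici 0) 0) (hmin : ∀ᶠ c in 𝓝[≥] (0 : ℝ), f 0 ≤ f c) : 0 ≤ d := by
  rw [hasDerivWithinAt_iff_tendsto_slope, Ici_sdiff_left] at hd
  refine ge_of_tendsto hd ?_
  filter_upwards [nhdsWithin_mono _ Ioi_subset_Ici_self hmin, self_mem_nhdsWithin] with c hc hpos
  rw [slope_def_field]
  exact div_nonneg (sub_nonneg.2 hc) (by simpa using (le_of_lt hpos))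

theorem mix_mem_of_mem {𝒮 : Set (TraceClass H)} (hconv : Convex ℝ 𝒮) {φ ρ : TraceClass H}
    (hρ : ρ ∈ 𝒮) {c₀ : ℝ} (hc₀ : c₀ ≤ 0) (hm : mix φ ρ c₀ ∈ 𝒮) {c : ℝ} (hc : c ∈ Icc c₀ 1) :
    mix φ ρ c ∈ 𝒮 := by
  have hpos : 0 < 1 - c₀ := by linarith
  -- These are the weights that express `c` as a convex combination of the endpoints `c₀` and `1`.
  have h := hconv hm hρ (a := (1 - c) / (1 - c₀)) (b := (c - c₀) / (1 - c₀))
    (div_nonneg (by linarith [hc.2]) hpos.le) (div_nonneg (by linarith [hc.1]) hpos.le)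
    (by field_simp; ring)
  convert h using 1
  simp only [mix, smul_add, smul_smul, add_assoc, ← add_smul]
  congr 2
  · field_simp
  · field_simp
    ring

/-- Dividing `(1 - c) φ ≥ -c ρ` by `1 - c` gives the premise of `SmoothNearMinimizer`. -/
theorem exists_smul_le_of_mix_nonneg {φ ρ : TraceClass H} {c : ℝ} (hc : c < 0)
    (hm : 0 ≤ (mix φ ρ c : H →L[ℂ] H)) :
    ∃ α : ℝ, 0 < α ∧ α • (ρ : H →L[ℂ] H) ≤ (φ : H →L[ℂ] H) := by
  have hpos : 0 < 1 - c := by linarith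
  refine ⟨-c / (1 - c), div_pos (by linarith) hpos, ?_⟩
  have h := smul_nonneg (inv_nonneg.2 hpos.le) hm
  rw [coe_mix, smul_add, smul_smul, smul_smul, inv_mul_cancel₀ hpos.ne', one_smul] at h
  rw [← sub_nonneg]
  convert h using 1
  rw [sub_eq_add_neg, ← neg_smul]
  congr 2
  field_simp

theorem toReal_epRate_le {T : QuantumDynamicalSemigroup H} {Q : TraceClass H → EReal}
    {𝒮 : Set (TraceClass H)} {φ ω : TraceClass H} (hmin : IsMinOn (epRate T Q) 𝒮 φ) (hω : ω ∈ 𝒮)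
    (hφ : epRate T Q φ ≠ ⊥) (htop : epRate T Q ω ≠ ⊤) :
    (epRate T Q φ).toReal ≤ (epRate T Q ω).toReal :=
  EReal.toReal_le_toReal (hmin hω) hφ htop

end EPRate

/-! ### The main theorem. -/

theorem mainTheorem7 {H : Type*} [NormedAddCommGroup H] [InnerProductSpace ℂ H] [CompleteSpace H]
    [TopologicalSpace.SeparableSpace H]
    (T : EPRate.QuantumDynamicalSemigroup H)
    (Q : EPRate.TraceClass H → EReal) (hQ : EPRate.IsLinearOnStates Q)
    (𝒮 : Set (EPRate.TraceClass H)) (h𝒮 : 𝒮 ⊆ EPRate.states H) (hconv : Convex ℝ 𝒮)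
    (φ ρ : EPRate.TraceClass H) (hφ : φ ∈ 𝒮) (hρ : ρ ∈ 𝒮)
    (hmin : IsMinOn (EPRate.epRate T Q) 𝒮 φ)
    (hrel : EPRate.relEntropy ρ φ ≠ ⊤)
    (hfinφ : EPRate.HasFiniteEPRate T Q φ) (hfinρ : EPRate.HasFiniteEPRate T Q ρ)
    (hreg : ∃ τ : ℝ, 0 < τ ∧ ∀ c ∈ Icc (0 : ℝ) 1, EPRate.TimeRegular T Q τ (EPRate.mix φ ρ c))
    (hsymm : EPRate.SymmetricPartials T Q φ ρ) :
    ∃ D : ℝ,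
      -- `D` is the derivative of the relative entropy `S(ρ(t)‖φ(t))` at `t = 0⁺`
      (∀ᶠ t in 𝓝[≥] (0 : ℝ), EPRate.relEntropy (T.map t ρ) (T.map t φ) ≠ ⊤) ∧
      HasDerivWithinAt (fun t => (EPRate.relEntropy (T.map t ρ) (T.map t φ)).toReal) D (Ici 0) 0 ∧
      ((-D : ℝ) : EReal) ≤ EPRate.epRate T Q ρ - EPRate.epRate T Q φ ∧
      ((∃ c : ℝ, c < 0 ∧ EPRate.mix φ ρ c ∈ 𝒮) → EPRate.SmoothNearMinimizer T Q φ ρ →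
        EPRate.epRate T Q ρ - EPRate.epRate T Q φ = ((-D : ℝ) : EReal)) ∧
      (0 ≤ EPRate.epRate T Q φ → ((-D : ℝ) : EReal) ≤ EPRate.epRate T Q ρ) := by
  open EPRate in
  obtain ⟨τ, hτ, hreg⟩ := hreg
  obtain ⟨d, g, hfinmix, hderiv, hg, hgderiv⟩ := hsymm
  obtain ⟨hSφ, hQφ, rφ, hrφ⟩ := hfinφ
  obtain ⟨hSρ, hQρ, rρ, hrρ⟩ := hfinρ
  have hregφ : TimeRegular T Q τ φ := by simpa using hreg 0 ⟨le_rfl, zero_le_one⟩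
  have hregρ : TimeRegular T Q τ ρ := by simpa using hreg 1 ⟨zero_le_one, le_rfl⟩
  have hepφ := epRate_eq hSφ hrφ hQφ (hQ.ne_bot φ (h𝒮 hφ))
  have hepρ := epRate_eq hSρ hrρ hQρ (hQ.ne_bot ρ (h𝒮 hρ))
  have hev : ∀ᶠ t in 𝓝[≥] (0 : ℝ), t ∈ Icc 0 τ := Icc_mem_nhdsGE hτ
  have hdSφ := (tendsto_entropyQuotient (hev.mono hregφ.entropy_ne_top)).1 hrφ
  have hdSρ := (tendsto_entropyQuotient (hev.mono hregρ.entropy_ne_top)).1 hrρ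
  have hkey : ∀ᶠ t in 𝓝[≥] (0 : ℝ), relEntropy (T.map t ρ) (T.map t φ) ≠ ⊤ ∧
      (relEntropy (T.map t ρ) (T.map t φ)).toReal =
        g t - (((entropy (T.map t ρ)).toReal - (entropy ρ).toReal) -
          ((entropy (T.map t φ)).toReal - (entropy φ).toReal)) -
          ((∫ s in (0 : ℝ)..t, (Q (T.map s ρ)).toReal) -
            ∫ s in (0 : ℝ)..t, (Q (T.map s φ)).toReal) + (relEntropy ρ φ).toReal := by
    filter_upwards [hev, hg] with t ht hgt
    exact relEntropy_map_eq hQ (h𝒮 hφ) (h𝒮 hρ) hrel hreg ht hgt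
  have hmix0 : ∀ c ∈ Icc (0 : ℝ) 1, mix φ ρ c ∈ 𝒮 := fun c hc =>
    mix_mem_of_mem hconv hρ le_rfl (by simpa using hφ) hc
  have hφbot : epRate T Q φ ≠ ⊥ := by rw [hepφ]; exact EReal.coe_ne_bot _
  have hd0 : 0 ≤ d := by
    refine nonneg_of_isMinOn_of_hasDerivWithinAt hderiv ?_
    filter_upwards [hfinmix, Icc_mem_nhdsGE zero_lt_one] with c hc hc1
    rw [mix_zero]
    exact toReal_epRate_le hmin (hmix0 c hc1) hφbot hc.1
  have hdiff : epRate T Q ρ - epRate T Q φ =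
      (((rρ + (Q ρ).toReal) - (rφ + (Q φ).toReal) : ℝ) : EReal) := by
    rw [hepρ, hepφ, ← EReal.coe_sub]
  -- The witness is the termwise derivative of `hkey` at `t = 0`, that is, `d - (Σ̇(ρ) - Σ̇(φ))`.
  refine ⟨d - (rρ - rφ) - ((Q ρ).toReal - (Q φ).toReal), hkey.mono fun t ht => ht.1, ?_, ?_, ?_, ?_⟩
  · have h := ((hgderiv.sub ((hdSρ.sub_const (entropy ρ).toReal).sub
      (hdSφ.sub_const (entropy φ).toReal))).sub
      ((hregρ.hasDerivWithinAt_integral_flow hτ).sub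
        (hregφ.hasDerivWithinAt_integral_flow hτ))).add_const (relEntropy ρ φ).toReal
    exact h.congr_of_eventuallyEq (hkey.mono fun t ht => ht.2)
      (hkey.self_of_nhdsWithin (mem_Ici.2 le_rfl)).2
  · rw [hdiff, EReal.coe_le_coe_iff]
    linarith
  · rintro ⟨c, hc, hmem⟩ hsmooth
    obtain ⟨ε, hε, hfin, hcd⟩ := hsmooth (exists_smul_le_of_mix_nonneg hc (h𝒮 hmem).1)
    have hnhds : Ioo (-ε) ε ∈ 𝓝 (0 : ℝ) := Ioo_mem_nhds (by linarith) hε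
    have hda : DifferentiableAt ℝ (fun c => (epRate T Q (mix φ ρ c)).toReal) 0 :=
      (hcd.differentiableOn one_ne_zero).differentiableAt hnhds
    have hloc : IsLocalMin (fun c => (epRate T Q (mix φ ρ c)).toReal) 0 := by
      filter_upwards [hnhds, Icc_mem_nhds hc zero_lt_one] with x hx hx1
      rw [mix_zero]
      exact toReal_epRate_le hmin (mix_mem_of_mem hconv hρ hc.le hmem hx1) hφbot (hfin x hx).1
    -- The two-sided derivative vanishes at an interior minimum and agrees with the right derivative
    -- `d`.
    have hd' : d = 0 := by
      rw [← hloc.deriv_eq_zero]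
      exact (uniqueDiffWithinAt_Ici (0 : ℝ)).eq_deriv _ hderiv hda.hasDerivAt.hasDerivWithinAt
    rw [hdiff, hd']
    congr 1
    ring
  · intro h0
    rw [hepφ] at h0
    rw [hepρ, EReal.coe_le_coe_iff]
    have : 0 ≤ rφ + (Q φ).toReal := by exact_mod_cast h0
    linarith
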